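/- Let $X$ be the space of unimodular lattices in $\mathbb R^3$, identified with $\mathrm{SL}_3(\mathbb R)/\mathrm{SL}_3(\mathbb Z)$ through $g\,\mathrm{SL}_3(\mathbb Z)\mapsto g\mathbb Z^3$, and let $\mu$ be the $\mathrm{SL}_3(\mathbb R)$-invariant Borel probability measure on $X$. For a function $f:\mathbb R^3\to\mathbb R$ with bounded support, its Siegel transform is $\widehat f(\Lambda)=\sum_{v\in\Lambda\setminus\{0\}}f(v)$, $\Lambda\in X$. Let $c>0$, $0\le p<3$ and $B>0$. Then there is a constant $C$, depending only on $c$, $p$ and $B$, such that for every $0<\beta\le B$ and every measurable function $f:\mathbb R^3\to[0,1]$ supported in $[-c,c]^2\times[-\beta,\beta]$, the function $\widehat f^{\,p}$ is $\mu$-integrable on $X$ and $$\int_X \widehat f^{\,p}\,d\mu\le C\,\beta^{p/3}.$$ (For $p=0$, the convention $0^0=1$ is used.) -/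

import Mathlib

open MeasureTheory Topology

/-! ### The group `SL₃(ℝ)`, its Borel structure, and the subgroup `SL₃(ℤ)` -/

/-- The real special linear group `G = SL₃(ℝ)`, with the topology induced from matrices. -/
abbrev SL3R : Type := Matrix.SpecialLinearGroup (Fin 3) ℝ

/-- `SL₃(ℝ)` carries its Borel `σ`-algebra. -/
instance SL3R.instMeasurableSpace : MeasurableSpace SL3R := borel SL3R

instance SL3R.instBorelSpace : BorelSpace SL3R := ⟨rfl⟩

instance SL3R.instLocallyCompactSpace : LocallyCompactSpace SL3R := by
  have : LocallyCompactSpace (Matrix (Fin 3) (Fin 3) ℝ) :=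
    inferInstanceAs (LocallyCompactSpace (Fin 3 → Fin 3 → ℝ))
  exact Matrix.SpecialLinearGroup.isClosedEmbedding_val.locallyCompactSpace

instance SL3R.instSecondCountableTopology : SecondCountableTopology SL3R := by
  have : SecondCountableTopology (Matrix (Fin 3) (Fin 3) ℝ) :=
    inferInstanceAs (SecondCountableTopology (Fin 3 → Fin 3 → ℝ))
  exact Matrix.SpecialLinearGroup.isClosedEmbedding_val.isEmbedding.secondCountableTopology

/-- The subgroup `Γ = SL₃(ℤ)` of `SL₃(ℝ)`. -/
def SL3Z : Subgroup SL3R :=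
  (Matrix.SpecialLinearGroup.map (n := Fin 3) (Int.castRingHom ℝ)).range

/-! ### The space of unimodular lattices -/

/-- The space `X ≃ G / Γ` of unimodular lattices in `ℝ³`; the coset `gΓ` stands for the lattice
`gℤ³`, see `LatticeSpace.lattice`.  The `σ`-algebra is the quotient of the Borel `σ`-algebra. -/
abbrev LatticeSpace : Type := SL3R ⧸ SL3Z

/-- The lattice `gℤ³ ⊆ ℝ³`, spanned over `ℤ` by the columns of `g`. -/
def columnLattice (g : SL3R) : Submodule ℤ (Fin 3 → ℝ) :=
  Submodule.span ℤ (Set.range fun j : Fin 3 => fun i : Fin 3 => g.1 i j)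

theorem columnLattice_mul_le (g γ : SL3R) (hγ : γ ∈ SL3Z) :
    columnLattice (g * γ) ≤ columnLattice g := by
  obtain ⟨z, rfl⟩ := hγ
  refine Submodule.span_le.2 ?_
  rintro _ ⟨j, rfl⟩
  have h : (fun i : Fin 3 => (g * Matrix.SpecialLinearGroup.map (Int.castRingHom ℝ) z).1 i j) =
      ∑ k : Fin 3, (z.1 k j) • (fun i : Fin 3 => g.1 i k) := by
    ext i
    simp [Matrix.mul_apply, Finset.sum_apply, mul_comm]
  have hmem : ∑ k : Fin 3, (z.1 k j) • (fun i : Fin 3 => g.1 i k) ∈ columnLattice g :=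
    Submodule.sum_mem _ fun k _ =>
      Submodule.smul_mem _ _ (Submodule.subset_span ⟨k, rfl⟩)
  rw [← h] at hmem
  exact hmem

theorem columnLattice_eq_of_leftRel (g h : SL3R) (hgh : g⁻¹ * h ∈ SL3Z) :
    columnLattice g = columnLattice h := by
  apply le_antisymm
  · have := columnLattice_mul_le h (g⁻¹ * h)⁻¹ (SL3Z.inv_mem hgh)
    simpa using this
  · have := columnLattice_mul_le g (g⁻¹ * h) hgh
    simpa using this

/-- The lattice `gℤ³` attached to a point `gΓ` of `X`. -/
def LatticeSpace.lattice (x : LatticeSpace) : Submodule ℤ (Fin 3 → ℝ) :=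
  Quotient.liftOn' x columnLattice fun g h hgh =>
    columnLattice_eq_of_leftRel g h (QuotientGroup.leftRel_apply.1 hgh)

/-- The Siegel transform `f̂(Λ) = ∑_{v ∈ Λ ∖ {0}} f(v)`. -/
noncomputable def siegelTransform (f : (Fin 3 → ℝ) → ℝ) (x : LatticeSpace) : ℝ :=
  ∑' v : ↥((x.lattice : Set (Fin 3 → ℝ)) \ {0}), f v

/-! ### The invariant probability measure on the space of lattices

`SL₃(ℝ)` is unimodular and `SL₃(ℤ)` is a lattice in it, so the invariant probability measure on
`G / Γ` is the image of the normalized restriction of Haar measure to any Borel set that contains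
exactly one element of each coset `gΓ`. -/

/-- An element of `SL₃(ℤ)` whose entries are at distance less than `1` from those of the identity
matrix is the identity. -/
theorem SL3Z_eq_one_of_near (γ : SL3R) (hγ : γ ∈ SL3Z)
    (hnear : ∀ i j : Fin 3, |γ.1 i j - (1 : Matrix (Fin 3) (Fin 3) ℝ) i j| < 1) : γ = 1 := by
  obtain ⟨z, rfl⟩ := hγ
  have hz : z = 1 := by
    refine Matrix.SpecialLinearGroup.ext z 1 fun i j => ?_
    have h := hnear i j
    have hcast : (1 : Matrix (Fin 3) (Fin 3) ℝ) i j =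
        (((1 : Matrix (Fin 3) (Fin 3) ℤ) i j : ℤ) : ℝ) := by
      simp only [Matrix.one_apply]; split_ifs <;> simp
    have hm : (Matrix.SpecialLinearGroup.map (Int.castRingHom ℝ) z).1 i j =
        ((z.1 i j : ℤ) : ℝ) := by simp
    rw [hm, hcast] at h
    have h' : |z.1 i j - (1 : Matrix (Fin 3) (Fin 3) ℤ) i j| < 1 := by exact_mod_cast h
    rw [Matrix.SpecialLinearGroup.coe_one]
    exact sub_eq_zero.1 (Int.abs_lt_one_iff.1 h')
  rw [hz, map_one]

/-- In a second countable topological group, a subgroup meeting some neighbourhood of `1` only in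
`1` has a Borel set of representatives for its left cosets. -/
theorem exists_borel_representatives_of_discrete {G : Type*} [Group G] [TopologicalSpace G]
    [IsTopologicalGroup G] [SecondCountableTopology G] [MeasurableSpace G] [BorelSpace G]
    (Γ : Subgroup G) (W : Set G) (hW : IsOpen W) (h1W : (1 : G) ∈ W)
    (hWΓ : ∀ γ ∈ Γ, γ ∈ W → γ = 1) :
    ∃ F : Set G, MeasurableSet F ∧
      ∀ x : G ⧸ Γ, ∃! g : G, g ∈ F ∧ (QuotientGroup.mk g : G ⧸ Γ) = x := by
  obtain ⟨V, hV, h1V, hinj⟩ : ∃ V : Set G, IsOpen V ∧ (1 : G) ∈ V ∧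
      ∀ g a b : G, a ∈ V → b ∈ V →
        (QuotientGroup.mk (g * a) : G ⧸ Γ) = QuotientGroup.mk (g * b) → a = b := by
    have hcont : Continuous fun q : G × G => q.1⁻¹ * q.2 :=
      continuous_fst.inv.mul continuous_snd
    obtain ⟨U, V, hU, hV, h1U, h1V, hUV⟩ :=
      isOpen_prod_iff.1 (hW.preimage hcont) 1 1 (by simpa using h1W)
    refine ⟨U ∩ V, hU.inter hV, ⟨h1U, h1V⟩, fun g a b ha hb hab => ?_⟩
    have hγ : a⁻¹ * b ∈ Γ := by
      have h := QuotientGroup.eq.1 hab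
      rwa [mul_inv_rev, mul_assoc, inv_mul_cancel_left] at h
    exact inv_mul_eq_one.1 (hWΓ _ hγ (hUV (Set.mk_mem_prod ha.1 hb.2)))
  let T : G → Set G := fun g => (fun a => g * a) '' V
  have hTo : ∀ g, IsOpen (T g) := fun g => (Homeomorph.mulLeft g).isOpenMap _ hV
  obtain ⟨s, hs, hsU⟩ := TopologicalSpace.isOpen_iUnion_countable T hTo
  have hcov : ⋃ g ∈ s, T g = Set.univ := by
    rw [hsU]
    exact Set.eq_univ_of_forall fun g => Set.mem_iUnion.2 ⟨g, 1, h1V, by simp⟩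
  have hne : s.Nonempty := by
    by_contra h
    rw [Set.not_nonempty_iff_eq_empty] at h
    subst h
    have : (1 : G) ∈ (Set.univ : Set G) := Set.mem_univ _
    rw [← hcov] at this
    simp at this
  obtain ⟨e, he⟩ := hs.exists_eq_range hne
  let π : G → G ⧸ Γ := QuotientGroup.mk
  let U : ℕ → Set G := fun n => T (e n)
  have hUcov : ∀ g, ∃ n, g ∈ U n := by
    intro g
    have : g ∈ (Set.univ : Set G) := Set.mem_univ _
    rw [← hcov, he] at this
    simpa [U] using this
  have hUinj : ∀ n, ∀ a ∈ U n, ∀ b ∈ U n, π a = π b → a = b := by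
    rintro n _ ⟨a, ha, rfl⟩ _ ⟨b, hb, rfl⟩ hab
    rw [hinj (e n) a b ha hb hab]
  let S : ℕ → Set G := fun n => π ⁻¹' (π '' U n)
  have hSo : ∀ n, IsOpen (S n) := fun n =>
    (QuotientGroup.isOpenMap_coe _ (hTo (e n))).preimage QuotientGroup.continuous_mk
  refine ⟨⋃ n, U n \ ⋃ m, ⋃ (_ : m < n), S m, ?_, ?_⟩
  · refine MeasurableSet.iUnion fun n => (hTo (e n)).measurableSet.diff ?_
    exact MeasurableSet.iUnion fun m => MeasurableSet.iUnion fun _ => (hSo m).measurableSet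
  · intro x
    classical
    have hex : ∃ n, x ∈ π '' U n := by
      obtain ⟨g, rfl⟩ := QuotientGroup.mk_surjective x
      obtain ⟨n, hn⟩ := hUcov g
      exact ⟨n, g, hn, rfl⟩
    obtain ⟨g, hg, hgx⟩ := Nat.find_spec hex
    refine ⟨g, ⟨?_, hgx⟩, ?_⟩
    · refine Set.mem_iUnion.2 ⟨Nat.find hex, hg, ?_⟩
      simp only [Set.mem_iUnion, not_exists]
      intro m hm hgm
      have hgm' : π g ∈ π '' U m := hgm
      rw [show π g = x from hgx] at hgm'
      exact Nat.find_min hex hm hgm'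
    · rintro h ⟨hh, hhx⟩
      obtain ⟨n, hn, hn'⟩ := Set.mem_iUnion.1 hh
      simp only [Set.mem_iUnion, not_exists] at hn'
      have hle : Nat.find hex ≤ n := Nat.find_min' hex ⟨h, hn, hhx⟩
      have heq : n = Nat.find hex := by
        by_contra hne'
        refine hn' _ (lt_of_le_of_ne hle (Ne.symm hne')) ?_
        exact ⟨g, hg, hgx.trans hhx.symm⟩
      subst heq
      exact hUinj _ h hn g hg (hhx.trans hgx.symm)

/-- There is a Borel set containing exactly one element of each coset `gΓ`. -/
theorem exists_borel_representatives : ∃ F : Set SL3R, MeasurableSet F ∧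
    ∀ x : LatticeSpace, ∃! g : SL3R, g ∈ F ∧ (QuotientGroup.mk g : LatticeSpace) = x := by
  refine exists_borel_representatives_of_discrete SL3Z (⋂ i : Fin 3, ⋂ j : Fin 3,
    {g : SL3R | |g.1 i j - (1 : Matrix (Fin 3) (Fin 3) ℝ) i j| < 1}) ?_ ?_ ?_
  · refine isOpen_iInter_of_finite fun i => isOpen_iInter_of_finite fun j => ?_
    have hc : Continuous fun g : SL3R => g.1 i j :=
      (continuous_apply j).comp ((continuous_apply i).comp continuous_subtype_val)
    exact isOpen_lt (hc.sub continuous_const).abs continuous_const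
  · simp
  · intro γ hγ hmem
    simp only [Set.mem_iInter] at hmem
    exact SL3Z_eq_one_of_near γ hγ hmem

/-- A Borel set containing exactly one element of each coset `gΓ`, i.e. a strict fundamental
domain for the action of `SL₃(ℤ)` on `SL₃(ℝ)` by right multiplication. -/
noncomputable def cosetRepresentatives : Set SL3R := exists_borel_representatives.choose

/-- The invariant probability measure `μ` on the space `X` of unimodular lattices:
`μ(A) = m({g ∈ F : gΓ ∈ A}) / m(F)` with `m` a Haar measure on `SL₃(ℝ)` and `F` a fundamental
domain for `SL₃(ℤ)`. -/
noncomputable def latticeMeasure : Measure LatticeSpace :=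
  (ProbabilityTheory.cond (Measure.haar : Measure SL3R) cosetRepresentatives).map
    (QuotientGroup.mk : SL3R → LatticeSpace)

/-! ### Reduced bases -/

/-! The transform is at most the number of nonzero lattice points in the box. A diagonal matrix of
determinant 1 turns the box into a cube of half-side `r` with `r ^ 3 = c ^ 2 * β`, so it suffices to
bound the p-th moment of the number of points in a cube by a constant times `r ^ p`.

Let a₁, a₂, a₃ be the Gram-Schmidt lengths of a reduced basis of the lattice, with product about 1,
and let Q = a₁⁴a₂² be its flag potential. If the cube contains a nonzero point, then r is at least a
constant times a₁, and the count, at most a product of factors of the shape r/aᵢ + 1, is O(r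
Q^(-1/3)) for bounded r (`IsReducedBasis.card_le`). Linearity in r gives the power of β; what
remains is that Q^(-p/3) is integrable over reduced bases.

Haar measure on the group is, up to a factor, the radial projection of Lebesgue measure on matrices
with determinant in [1, 2] (`exists_coneMeasure_eq_smul_haar`), so this is a Euclidean integral over
triples of vectors. With s = p/3, the third vector contributes a bounded volume, the second turns
Q^(-s) into a multiple of |w₀|^(-3s), and this is integrable near the origin of ℝ³ because s < 1
(`lintegral_flagPotential_lt_top`).

Reduced bases exist by near-minimality of Q on an orbit (`exists_isReducedBasis`). Hence the reduced
elements meet every coset, and integrals over a fundamental domain are at most integrals over them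
(`setLIntegral_le_of_forall_exists_mul_mem`); overlaps do no harm to an upper bound. -/

open Matrix in
/-- The Gram determinant `|a|²|b|² - ⟨a, b⟩²` of two vectors. -/
def gramTwo (a b : Fin 3 → ℝ) : ℝ := (a ⬝ᵥ a) * (b ⬝ᵥ b) - (a ⬝ᵥ b) ^ 2

open Matrix in
/-- `|a|²` times the component of `b` orthogonal to `a`. -/
def orthComponent (a b : Fin 3 → ℝ) : Fin 3 → ℝ := (a ⬝ᵥ a) • b - (a ⬝ᵥ b) • a

/-- The matrix with columns `w 0`, `w 1`, `w 2`. -/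
def colMatrix (w : Fin 3 → Fin 3 → ℝ) : Matrix (Fin 3) (Fin 3) ℝ := Matrix.of fun i j => w j i

open Matrix in
/-- The product of the squared covolumes of the first two steps of the flag spanned by `w`. -/
def flagPotential (w : Fin 3 → Fin 3 → ℝ) : ℝ := (w 0 ⬝ᵥ w 0) * gramTwo (w 0) (w 1)

open Matrix in
/-- A size-reduced triple of vectors whose successive Gram-Schmidt lengths drop at most by a
factor `√2`; the conditions are written without denominators. -/
structure IsReducedBasis (w : Fin 3 → Fin 3 → ℝ) : Prop where
  abs_dot_one : |w 0 ⬝ᵥ w 1| ≤ (w 0 ⬝ᵥ w 0) / 2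
  abs_dot_two : |w 0 ⬝ᵥ w 2| ≤ (w 0 ⬝ᵥ w 0) / 2
  abs_orth_two : |orthComponent (w 0) (w 1) ⬝ᵥ w 2| ≤ gramTwo (w 0) (w 1) / 2
  sq_le_gram : (w 0 ⬝ᵥ w 0) ^ 2 / 2 ≤ gramTwo (w 0) (w 1)
  gram_sq_le : gramTwo (w 0) (w 1) ^ 2 / 2 ≤ (w 0 ⬝ᵥ w 0) * (colMatrix w).det ^ 2

theorem colMatrix_det (w : Fin 3 → Fin 3 → ℝ) : (colMatrix w).det =
    w 0 0 * w 1 1 * w 2 2 - w 0 0 * w 2 1 * w 1 2 - w 1 0 * w 0 1 * w 2 2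
      + w 1 0 * w 2 1 * w 0 2 + w 2 0 * w 0 1 * w 1 2 - w 2 0 * w 1 1 * w 0 2 := by
  rw [Matrix.det_fin_three]; simp [colMatrix]

section
open Matrix

theorem dotProduct_self_nonneg' (a : Fin 3 → ℝ) : 0 ≤ a ⬝ᵥ a := by
  simp only [dotProduct, Fin.sum_univ_three]; nlinarith [mul_self_nonneg (a 0), mul_self_nonneg (a 1), mul_self_nonneg (a 2)]

theorem gramTwo_eq_cross (a b : Fin 3 → ℝ) : gramTwo a b =
    (a 1 * b 2 - a 2 * b 1) ^ 2 + (a 2 * b 0 - a 0 * b 2) ^ 2 + (a 0 * b 1 - a 1 * b 0) ^ 2 := by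
  simp only [gramTwo, dotProduct, Fin.sum_univ_three]; ring

theorem gramTwo_nonneg (a b : Fin 3 → ℝ) : 0 ≤ gramTwo a b := by
  rw [gramTwo_eq_cross]; positivity

theorem dot_sq_le (a b : Fin 3 → ℝ) : (a ⬝ᵥ b) ^ 2 ≤ (a ⬝ᵥ a) * (b ⬝ᵥ b) :=
  sub_nonneg.1 (gramTwo_nonneg a b)

/-- Sylvester's identity for the minors of the 3×3 Gram matrix bordering its first entry; the last
square is that of the mixed minor. It turns size reduction plus an exchange inequality into
`gram_sq_le`. -/
theorem gram_mul_gram (w : Fin 3 → Fin 3 → ℝ) :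
    gramTwo (w 0) (w 1) * gramTwo (w 0) (w 2) =
      (w 0 ⬝ᵥ w 0) * (colMatrix w).det ^ 2 + (orthComponent (w 0) (w 1) ⬝ᵥ w 2) ^ 2 := by
  simp only [gramTwo, orthComponent, colMatrix_det, dotProduct, Fin.sum_univ_three, Pi.sub_apply, Pi.smul_apply, smul_eq_mul]
  ring

theorem orthComponent_dot_self (a b : Fin 3 → ℝ) :
    orthComponent a b ⬝ᵥ orthComponent a b = (a ⬝ᵥ a) * gramTwo a b := by
  simp only [gramTwo, orthComponent, dotProduct, Fin.sum_univ_three, Pi.sub_apply, Pi.smul_apply, smul_eq_mul]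
  ring

theorem cross_dot_self (a b : Fin 3 → ℝ) : (a ⨯₃ b) ⬝ᵥ (a ⨯₃ b) = gramTwo a b := by
  simp only [gramTwo_eq_cross, cross_apply, dotProduct, Fin.sum_univ_three]
  simp; ring

/-- A vector of length at most `σ` in the lattice spanned by `w` has small coordinates. -/
theorem coord_bound (w : Fin 3 → Fin 3 → ℝ) (z : Fin 3 → ℝ) (σ : ℝ)
    (h : (∑ j, z j • w j) ⬝ᵥ (∑ j, z j • w j) ≤ σ ^ 2) :
    (z 2 * (colMatrix w).det) ^ 2 ≤ gramTwo (w 0) (w 1) * σ ^ 2 ∧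
    (z 2 = 0 → (z 1 * gramTwo (w 0) (w 1)) ^ 2 ≤ (w 0 ⬝ᵥ w 0) * gramTwo (w 0) (w 1) * σ ^ 2) ∧
    (z 2 = 0 → z 1 = 0 → (z 0 * (w 0 ⬝ᵥ w 0)) ^ 2 ≤ (w 0 ⬝ᵥ w 0) * σ ^ 2) := by
  set x := ∑ j, z j • w j with hx
  have hxi : ∀ i, x i = z 0 * w 0 i + z 1 * w 1 i + z 2 * w 2 i := by
    intro i; simp [hx, Fin.sum_univ_three]
  -- The last nonzero coordinate is isolated by pairing `x` with a vector orthogonal to the earlier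
  -- basis vectors: the cross product, then the orthogonal component, then `w 0`. Cauchy-Schwarz
  -- bounds each pairing.
  refine ⟨?_, fun h2 => ?_, fun h2 h1 => ?_⟩
  · have e : z 2 * (colMatrix w).det = (w 0 ⨯₃ w 1) ⬝ᵥ x := by
      simp only [colMatrix_det, cross_apply, dotProduct, Fin.sum_univ_three, hxi]
      simp; ring
    rw [e, ← cross_dot_self]
    exact (dot_sq_le _ _).trans (mul_le_mul_of_nonneg_left h (dotProduct_self_nonneg' _))
  · have e : z 1 * gramTwo (w 0) (w 1) = orthComponent (w 0) (w 1) ⬝ᵥ x := by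
      simp only [gramTwo, orthComponent, dotProduct, Fin.sum_univ_three, hxi, Pi.sub_apply, Pi.smul_apply, smul_eq_mul, h2]
      ring
    rw [e, ← orthComponent_dot_self]
    exact (dot_sq_le _ _).trans (mul_le_mul_of_nonneg_left h (dotProduct_self_nonneg' _))
  · have e : z 0 * (w 0 ⬝ᵥ w 0) = w 0 ⬝ᵥ x := by
      simp only [dotProduct, Fin.sum_univ_three, hxi, h2, h1]
      ring
    rw [e]
    exact (dot_sq_le _ _).trans (mul_le_mul_of_nonneg_left h (dotProduct_self_nonneg' _))

end

/-! ### Counting integer points -/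

theorem card_le_of_abs_sub_le (A : Finset ℤ) (L : ℝ) (hL : 0 ≤ L)
    (h : ∀ a ∈ A, ∀ b ∈ A, |(a : ℝ) - b| ≤ L) : (A.card : ℝ) ≤ L + 1 := by
  rcases A.eq_empty_or_nonempty with rfl | hA
  · simp; positivity
  have hsub : A ⊆ Finset.Icc (A.min' hA) (A.min' hA + ⌊L⌋) := by
    intro a ha
    rw [Finset.mem_Icc]
    refine ⟨A.min'_le a ha, ?_⟩
    have h1 := (abs_le.1 (h a ha _ (A.min'_mem hA))).2
    have h2 : a - A.min' hA ≤ ⌊L⌋ := Int.le_floor.2 (by push_cast; exact h1)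
    linarith
  have hc := Finset.card_le_card hsub
  rw [Int.card_Icc] at hc
  have hfl : 0 ≤ ⌊L⌋ := Int.floor_nonneg.2 hL
  have h3 : (A.card : ℤ) ≤ ⌊L⌋ + 1 := by omega
  have h4 : (A.card : ℝ) ≤ ⌊L⌋ + 1 := by exact_mod_cast h3
  linarith [Int.floor_le L]

theorem card_le_of_fiber_card_le {α : Type*} (T : Finset α) (f : α → ℤ) (L K : ℝ)
    (hL : 0 ≤ L) (hK : 0 ≤ K) (h : ∀ a ∈ T, ∀ b ∈ T, |(f a : ℝ) - f b| ≤ L)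
    (hf : ∀ n, ((T.filter fun a => f a = n).card : ℝ) ≤ K) : (T.card : ℝ) ≤ K * (L + 1) := by
  classical
  rw [Finset.card_eq_sum_card_image f T]
  push_cast
  calc ∑ b ∈ T.image f, ((T.filter fun a => f a = b).card : ℝ)
      ≤ ∑ b ∈ T.image f, K := Finset.sum_le_sum fun b _ => hf b
    _ = K * ((T.image f).card : ℝ) := by simp [mul_comm]
    _ ≤ K * (L + 1) := by
      refine mul_le_mul_of_nonneg_left (card_le_of_abs_sub_le _ L hL ?_) hK
      intro a ha b hb
      obtain ⟨a', ha', rfl⟩ := Finset.mem_image.1 ha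
      obtain ⟨b', hb', rfl⟩ := Finset.mem_image.1 hb
      exact h a' ha' b' hb'

/-- Fibre over the last coordinate, then over the middle one. The hypotheses are triangular because
`coord_bound`, applied to differences of points, controls a coordinate only when the later ones
agree. -/
theorem card_le_prod (T : Finset (Fin 3 → ℤ)) (L₀ L₁ L₂ : ℝ) (h₀ : 0 ≤ L₀) (h₁ : 0 ≤ L₁)
    (h₂ : 0 ≤ L₂)
    (h : ∀ a ∈ T, ∀ b ∈ T, |(a 2 : ℝ) - b 2| ≤ L₂ ∧ (a 2 = b 2 → |(a 1 : ℝ) - b 1| ≤ L₁) ∧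
      (a 2 = b 2 → a 1 = b 1 → |(a 0 : ℝ) - b 0| ≤ L₀)) :
    (T.card : ℝ) ≤ (L₀ + 1) * (L₁ + 1) * (L₂ + 1) := by
  classical
  refine card_le_of_fiber_card_le T (fun a => a 2) L₂ _ h₂ (by positivity)
    (fun a ha b hb => (h a ha b hb).1) fun n => ?_
  refine card_le_of_fiber_card_le _ (fun a => a 1) L₁ _ h₁ (by positivity) ?_ fun k => ?_
  · intro a ha b hb
    simp only [Finset.mem_filter] at ha hb
    exact (h a ha.1 b hb.1).2.1 (ha.2.trans hb.2.symm)
  · have := card_le_of_fiber_card_le (((T.filter fun a => a 2 = n)).filter fun a => a 1 = k)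
      (fun a => a 0) L₀ 1 h₀ zero_le_one ?_ fun l => ?_
    · simpa using this
    · intro a ha b hb
      simp only [Finset.mem_filter] at ha hb
      exact (h a ha.1.1 b hb.1.1).2.2 (ha.1.2.trans hb.1.2.symm) (ha.2.trans hb.2.symm)
    · norm_cast
      refine Finset.card_le_one.2 fun a ha b hb => ?_
      simp only [Finset.mem_filter] at ha hb
      funext i
      fin_cases i
      · exact ha.2.trans hb.2.symm
      · exact ha.1.2.trans hb.1.2.symm
      · exact ha.1.1.2.trans hb.1.1.2.symm

/-- Here `q` is the cube root of the flag potential. The first factor is at most `5 * (σ / a₁)`, and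
the third is bounded because the product of the lengths and their slow decrease force `a₃ ≥ 1 / 2`.
Expanding the middle factor leaves terms in `1 / a₁` and `1 / (a₁ * a₂)`, both at most `2 / q`;
hence a single power of `σ / q`. -/
theorem gramSchmidt_count_le (a₁ a₂ a₃ q σ R : ℝ) (h₁ : 0 < a₁) (h₂ : 0 < a₂) (h₃ : 0 < a₃)
    (h12 : a₁ ≤ 2 * a₂) (h23 : a₂ ≤ 2 * a₃) (hD1 : 1 ≤ a₁ * a₂ * a₃) (hD2 : a₁ * a₂ * a₃ ≤ 2)
    (hq : 0 < q) (hq3 : q ^ 3 = a₁ ^ 4 * a₂ ^ 2) (hσ : a₁ / 4 ≤ σ) (hσR : σ ≤ R) :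
    (σ / a₁ + 1) * (σ / a₂ + 1) * (σ / a₃ + 1) ≤ 20 * (R + 1) * (2 * R + 1) * (σ / q) := by
  have hσ0 : 0 < σ := by linarith
  have hR0 : 0 < R := by linarith
  have e1 : σ / a₁ + 1 ≤ 5 * (σ / a₁) := by
    have : 1 ≤ 4 * (σ / a₁) := by rw [← mul_div_assoc, le_div_iff₀ h₁]; linarith
    linarith
  have ha3 : 1 / 2 ≤ a₃ := by
    by_contra hc
    push Not at hc
    have h2' : a₂ < 1 := by linarith
    have h1' : a₁ < 2 := by linarith
    have : a₁ * a₂ < 2 * 1 := by nlinarith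
    nlinarith [mul_pos h₁ h₂]
  have e3 : σ / a₃ + 1 ≤ 2 * R + 1 := by
    have : σ / a₃ ≤ 2 * R := by rw [div_le_iff₀ h₃]; nlinarith
    linarith
  have hqa : q ≤ 2 * a₁ := by
    refine le_of_pow_le_pow_left₀ (n := 3) (by norm_num) (by positivity) ?_
    rw [hq3]
    have : a₁ * a₂ ^ 2 ≤ 8 := by nlinarith [mul_pos h₁ h₂]
    nlinarith [pow_pos h₁ 3]
  have hqb : q ≤ 2 * a₁ * a₂ := by
    refine le_of_pow_le_pow_left₀ (n := 3) (by norm_num) (by positivity) ?_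
    rw [hq3]
    have : a₁ ≤ 8 * a₂ := by linarith
    have h' : 0 < a₁ ^ 3 * a₂ ^ 2 := by positivity
    nlinarith
  have e2 : (σ / a₁) * (σ / a₂ + 1) ≤ 4 * (R + 1) * (σ / q) := by
    have f1 : σ / a₁ ≤ 2 * (σ / q) := by
      rw [← mul_div_assoc, div_le_div_iff₀ h₁ hq]; nlinarith
    have f2 : σ / a₁ * (σ / a₂) ≤ 2 * R * (σ / q) := by
      rw [div_mul_div_comm, ← mul_div_assoc, div_le_div_iff₀ (by positivity) hq]
      have : σ * q ≤ R * (2 * a₁ * a₂) := mul_le_mul hσR hqb hq.le hR0.le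
      nlinarith
    have : 0 < σ / q := by positivity
    nlinarith
  have hpos3 : 0 ≤ σ / a₃ + 1 := by positivity
  calc (σ / a₁ + 1) * (σ / a₂ + 1) * (σ / a₃ + 1)
      ≤ (5 * (σ / a₁)) * (σ / a₂ + 1) * (2 * R + 1) := by gcongr
    _ = 5 * (2 * R + 1) * ((σ / a₁) * (σ / a₂ + 1)) := by ring
    _ ≤ 5 * (2 * R + 1) * (4 * (R + 1) * (σ / q)) := by gcongr
    _ = _ := by ring

open Matrix in
theorem gram_pos_of_one_le_det {w : Fin 3 → Fin 3 → ℝ} (hD : 1 ≤ (colMatrix w).det) :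
    0 < w 0 ⬝ᵥ w 0 ∧ 0 < gramTwo (w 0) (w 1) := by
  have h := gram_mul_gram w
  have hg : 0 < gramTwo (w 0) (w 1) := by
    rcases (gramTwo_nonneg (w 0) (w 1)).lt_or_eq with h' | h'
    · exact h'
    exfalso
    rw [gramTwo_eq_cross] at h'
    have h1 : w 0 1 * w 1 2 - w 0 2 * w 1 1 = 0 := by nlinarith
    have h2 : w 0 2 * w 1 0 - w 0 0 * w 1 2 = 0 := by nlinarith
    have h3 : w 0 0 * w 1 1 - w 0 1 * w 1 0 = 0 := by nlinarith
    have : (colMatrix w).det = 0 := by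
      rw [colMatrix_det]; linear_combination w 2 0 * h1 + w 2 1 * h2 + w 2 2 * h3
    linarith
  refine ⟨?_, hg⟩
  rcases (dotProduct_self_nonneg' (w 0)).lt_or_eq with h' | h'
  · exact h'
  · unfold gramTwo at hg
    rw [← h'] at hg
    nlinarith [sq_nonneg (w 0 ⬝ᵥ w 1)]

open Matrix in
/-- The number of nonzero points of a reduced lattice in a cube. -/
theorem IsReducedBasis.card_le {w : Fin 3 → Fin 3 → ℝ} (hw : IsReducedBasis w)
    (hD1 : 1 ≤ (colMatrix w).det) (hD2 : (colMatrix w).det ≤ 2) {ρ R : ℝ} (hρ : 0 ≤ ρ)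
    (hR : ρ ≤ R) (T : Finset (Fin 3 → ℤ)) (hT0 : (0 : Fin 3 → ℤ) ∉ T)
    (hT : ∀ z ∈ T, ∀ i, |(∑ j, (z j : ℝ) • w j) i| ≤ ρ) :
    (T.card : ℝ) ≤ 80 * (4 * R + 1) * (8 * R + 1) * ρ * flagPotential w ^ (-(1 / 3) : ℝ) := by
  obtain ⟨hd1, hd2⟩ := gram_pos_of_one_le_det hD1
  have hR0 : 0 ≤ R := hρ.trans hR
  have hQ : 0 < flagPotential w := mul_pos hd1 hd2
  rcases T.eq_empty_or_nonempty with rfl | ⟨z₀, hz₀⟩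
  · simp only [Finset.card_empty, Nat.cast_zero]; positivity
  set d₁ := w 0 ⬝ᵥ w 0 with hd₁
  set d₂ := gramTwo (w 0) (w 1) with hd₂
  set D := (colMatrix w).det with hDdef
  have hD0 : 0 < D := by linarith
  have s1 := Real.sqrt_pos.2 hd1
  have s2 := Real.sqrt_pos.2 hd2
  have q1 := Real.sq_sqrt hd1.le
  have q2 := Real.sq_sqrt hd2.le
  set a := √d₁
  set b := √d₂
  -- Differences of points of `T` have entries at most `2 * ρ`, hence length at most 2√3 ρ, which is
  -- below `4 * ρ`.
  set σ := 4 * ρ with hσ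
  have hσ0 : 0 ≤ σ := by positivity
  -- the three coordinate estimates
  have key : ∀ z : Fin 3 → ℝ, (∀ i, |(∑ j, z j • w j) i| ≤ 2 * ρ) →
      |z 2| ≤ σ / (D / b) ∧ (z 2 = 0 → |z 1| ≤ σ / (b / a)) ∧
      (z 2 = 0 → z 1 = 0 → |z 0| ≤ σ / a) := by
    intro z hz
    have hn : (∑ j, z j • w j) ⬝ᵥ (∑ j, z j • w j) ≤ σ ^ 2 := by
      have h3 : ∀ i, (∑ j, z j • w j) i * (∑ j, z j • w j) i ≤ (2 * ρ) ^ 2 := by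
        intro i
        rw [← sq, ← sq_abs]
        exact pow_le_pow_left₀ (abs_nonneg _) (hz i) 2
      simp only [dotProduct, Fin.sum_univ_three] at h3 ⊢
      have := h3 0; have := h3 1; have := h3 2
      nlinarith [sq_nonneg ρ]
    obtain ⟨c1, c2, c3⟩ := coord_bound w z σ hn
    rw [← hd₂, ← hDdef] at c1
    rw [← hd₂, ← hd₁] at c2
    rw [← hd₁] at c3
    refine ⟨?_, fun h2 => ?_, fun h2 h1 => ?_⟩
    · rw [le_div_iff₀ (by positivity), ← mul_div_assoc, div_le_iff₀ s2]
      refine le_of_sq_le_sq ?_ (by positivity)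
      rw [mul_pow, mul_pow, sq_abs, q2]; linarith [c1, mul_pow (z 2) D 2]
    · rw [le_div_iff₀ (by positivity), ← mul_div_assoc, div_le_iff₀ s1]
      refine le_of_sq_le_sq ?_ (by positivity)
      rw [mul_pow, mul_pow, sq_abs, q2, q1]
      have := c2 h2
      refine le_of_mul_le_mul_right ?_ hd2
      nlinarith
    · rw [le_div_iff₀ (by positivity)]
      refine le_of_sq_le_sq ?_ (by positivity)
      rw [mul_pow, sq_abs, q1]
      have := c3 h2 h1
      refine le_of_mul_le_mul_right ?_ hd1
      nlinarith
  have hA : 0 < b / a := by positivity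
  have hB : 0 < D / b := by positivity
  have h12 : a ≤ 2 * (b / a) := by
    rw [← mul_div_assoc, le_div_iff₀ s1]
    refine le_of_sq_le_sq ?_ (by positivity)
    have := hw.sq_le_gram
    rw [← hd₁, ← hd₂] at this
    rw [mul_pow, mul_pow, q1, q2]; nlinarith
  have h23 : b / a ≤ 2 * (D / b) := by
    rw [← mul_div_assoc, div_le_div_iff₀ s1 s2]
    refine le_of_sq_le_sq ?_ (by positivity)
    have := hw.gram_sq_le
    rw [← hd₁, ← hd₂, ← hDdef] at this
    rw [mul_pow, mul_pow, mul_pow, q1, q2]; nlinarith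
  have hDe : a * (b / a) * (D / b) = D := by field_simp
  -- The last nonzero coordinate of the nonzero integer vector `z₀` is at least 1 in modulus, so one
  -- Gram-Schmidt length is at most `σ`; each of them is at least `a / 4` by `h12` and `h23`.
  have hσa : a / 4 ≤ σ := by
    have hx : ∀ i, |(∑ j, (z₀ j : ℝ) • w j) i| ≤ 2 * ρ := fun i => by
      linarith [hT z₀ hz₀ i]
    obtain ⟨c1, c2, c3⟩ := key (fun j => (z₀ j : ℝ)) hx
    have one_le : ∀ n : ℤ, n ≠ 0 → (1 : ℝ) ≤ |(n : ℝ)| := fun n hn => by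
      exact_mod_cast Int.one_le_abs hn
    by_cases h2 : z₀ 2 = 0
    · by_cases h1 : z₀ 1 = 0
      · have h0 : z₀ 0 ≠ 0 := by
          intro h0
          apply hT0
          convert hz₀
          funext i; fin_cases i <;> simp [h0, h1, h2]
        have := (one_le _ h0).trans (c3 (by simp [h2]) (by simp [h1]))
        rw [le_div_iff₀ s1] at this; linarith
      · have := (one_le _ h1).trans (c2 (by simp [h2]))
        rw [le_div_iff₀ hA] at this; linarith
    · have := (one_le _ h2).trans c1
      rw [le_div_iff₀ hB] at this; linarith
  have hcard := card_le_prod T (σ / a) (σ / (b / a)) (σ / (D / b)) (by positivity)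
    (by positivity) (by positivity) fun z hz z' hz' => by
      obtain ⟨c1, c2, c3⟩ := key (fun j => (z j : ℝ) - z' j) fun i => by
        have e : (∑ j, ((z j : ℝ) - z' j) • w j) i =
            (∑ j, (z j : ℝ) • w j) i - (∑ j, (z' j : ℝ) • w j) i := by
          simp only [sub_smul, Finset.sum_sub_distrib, Pi.sub_apply]
        rw [e]
        linarith [abs_sub ((∑ j, (z j : ℝ) • w j) i) ((∑ j, (z' j : ℝ) • w j) i), hT z hz i, hT z' hz' i]
      exact ⟨c1, fun h => c2 (by simp [h]), fun h h' => c3 (by simp [h]) (by simp [h'])⟩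
  set q := flagPotential w ^ (1 / 3 : ℝ) with hq
  have hq0 : 0 < q := Real.rpow_pos_of_pos hQ _
  have hq3 : q ^ 3 = a ^ 4 * (b / a) ^ 2 := by
    rw [hq, ← Real.rpow_natCast, ← Real.rpow_mul hQ.le]
    norm_num
    rw [div_pow, q2, show a ^ 4 = d₁ * a ^ 2 by rw [← q1]; ring]
    field_simp
    rfl
  refine hcard.trans ((gramSchmidt_count_le a (b / a) (D / b) q σ (4 * R) s1 hA hB h12 h23
    (by rw [hDe]; exact hD1) (by rw [hDe]; exact hD2) hq0 hq3 hσa (by rw [hσ]; linarith)).trans (le_of_eq ?_))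
  rw [Real.rpow_neg hQ.le, ← hq, hσ]
  field_simp
  ring

/-! ### Existence of reduced bases -/

section
open Matrix

/-- The columns of an element of `SL₃(ℝ)`. -/
def SL3R.cols (g : SL3R) : Fin 3 → Fin 3 → ℝ := fun j i => g.1 i j

theorem SL3R.colMatrix_cols (g : SL3R) : colMatrix g.cols = g.1 := by
  ext i j; rfl

theorem SL3Z_exists_of_int (A : Matrix (Fin 3) (Fin 3) ℤ) (hA : A.det = 1) :
    ∃ γ ∈ SL3Z, ∀ g : SL3R, ∀ j, (g * γ).cols j = ∑ k, (A k j : ℝ) • g.cols k := by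
  obtain ⟨γ, hγ⟩ : ∃ γ : SL3R, γ = Matrix.SpecialLinearGroup.map (Int.castRingHom ℝ) ⟨A, hA⟩ :=
    ⟨_, rfl⟩
  have hγe : ∀ i j, γ.1 i j = (A i j : ℝ) := fun i j => by rw [hγ]; rfl
  refine ⟨γ, ⟨⟨A, hA⟩, hγ.symm⟩, fun g j => ?_⟩
  ext i
  have e : (g * γ).cols j i = ∑ k, g.1 i k * γ.1 k j := by
    simp [SL3R.cols, Matrix.mul_apply]
  rw [e]
  simp [SL3R.cols, hγe, Fin.sum_univ_three, mul_comm]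

theorem sum_sq_mulVec_le (A : Matrix (Fin 3) (Fin 3) ℝ) (x : Fin 3 → ℝ) :
    (A *ᵥ x) ⬝ᵥ (A *ᵥ x) ≤ (∑ i, ∑ j, A i j ^ 2) * (x ⬝ᵥ x) := by
  rw [Finset.sum_mul]
  refine Finset.sum_le_sum fun i _ => ?_
  rw [← sq]
  have := Finset.sum_mul_sq_le_sq_mul_sq Finset.univ (fun j => A i j) x
  simpa [Matrix.mulVec, dotProduct, sq] using this

theorem one_le_dot_self_of_int (z : Fin 3 → ℤ) (hz : z ≠ 0) :
    1 ≤ (fun i => (z i : ℝ)) ⬝ᵥ (fun i => (z i : ℝ)) := by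
  have h : (1 : ℤ) ≤ z 0 * z 0 + z 1 * z 1 + z 2 * z 2 := by
    by_contra hc
    have h0 := mul_self_nonneg (z 0)
    have h1 := mul_self_nonneg (z 1)
    have h2 := mul_self_nonneg (z 2)
    apply hz
    funext i
    fin_cases i
    · exact mul_self_eq_zero.1 (show z 0 * z 0 = 0 by linarith)
    · exact mul_self_eq_zero.1 (show z 1 * z 1 = 0 by linarith)
    · exact mul_self_eq_zero.1 (show z 2 * z 2 = 0 by linarith)
  simp only [dotProduct, Fin.sum_univ_three]
  exact_mod_cast h

/-- The flag potential is bounded away from zero on an orbit of `SL₃(ℤ)`. -/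
theorem exists_flagPotential_lower_bound (g : SL3R) :
    ∃ ε : ℝ, 0 < ε ∧ ∀ γ ∈ SL3Z, ε ≤ flagPotential (g * γ).cols := by
  -- Squared Hilbert-Schmidt norms of g⁻¹ and gᵀ; the added 1 makes them invertible.
  set K := (∑ i, ∑ j, g⁻¹.1 i j ^ 2) + 1 with hK
  set K' := (∑ i, ∑ j, (g.1ᵀ) i j ^ 2) + 1 with hK'
  have hS : 0 ≤ ∑ i, ∑ j, g⁻¹.1 i j ^ 2 :=
    Finset.sum_nonneg fun _ _ => Finset.sum_nonneg fun _ _ => sq_nonneg _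
  have hS' : 0 ≤ ∑ i, ∑ j, (g.1ᵀ) i j ^ 2 :=
    Finset.sum_nonneg fun _ _ => Finset.sum_nonneg fun _ _ => sq_nonneg _
  have hKp : 0 < K := by positivity
  have hKp' : 0 < K' := by positivity
  refine ⟨K⁻¹ * K'⁻¹, by positivity, fun γ hγ => ?_⟩
  obtain ⟨A, rfl⟩ := hγ
  set γ := Matrix.SpecialLinearGroup.map (Int.castRingHom ℝ) A with hγ
  have hγe : ∀ i j, γ.1 i j = (A.1 i j : ℝ) := fun i j => by simp [hγ]
  set w := (g * γ).cols with hw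
  have hwe : ∀ j i, w j i = ∑ k, g.1 i k * γ.1 k j := fun j i => by
    simp [hw, SL3R.cols, Matrix.mul_apply]
  have hdetA : A.1.det = 1 := A.2
  -- g⁻¹ carries the first column of gγ to a nonzero integer vector, which has length at least 1.
  have b1 : 1 ≤ K * (w 0 ⬝ᵥ w 0) := by
    have hz : (fun i => A.1 i 0) ≠ 0 := by
      intro h0
      have : ∀ i, A.1 i 0 = 0 := fun i => congrFun h0 i
      rw [Matrix.det_fin_three] at hdetA
      simp [this] at hdetA
    have e : (fun i => (A.1 i 0 : ℝ)) = g⁻¹.1 *ᵥ w 0 := by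
      have h1 : w 0 = g.1 *ᵥ (fun i => (A.1 i 0 : ℝ)) := by
        ext i; simp [hwe, hγe, Matrix.mulVec, dotProduct]
      rw [h1, Matrix.mulVec_mulVec]
      have : g⁻¹.1 * g.1 = 1 := by
        exact congrArg Subtype.val (inv_mul_cancel g)
      rw [this, Matrix.one_mulVec]
    have h1 := one_le_dot_self_of_int _ hz
    rw [e] at h1
    have := sum_sq_mulVec_le g⁻¹.1 (w 0)
    nlinarith [dotProduct_self_nonneg' (w 0)]
  -- As det g = 1, gᵀ carries (gu) × (gv) to u × v, so the cross product of the first two columns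
  -- goes to a nonzero integer vector.
  have b2 : 1 ≤ K' * gramTwo (w 0) (w 1) := by
    set z : Fin 3 → ℤ := (fun i => A.1 i 0) ⨯₃ (fun i => A.1 i 1) with hz
    have hz0 : z ≠ 0 := by
      intro h0
      have t0 := congrFun h0 0
      have t1 := congrFun h0 1
      have t2 := congrFun h0 2
      simp [hz, cross_apply] at t0 t1 t2
      rw [Matrix.det_fin_three] at hdetA
      have : (1 : ℤ) = 0 := by
        linear_combination -hdetA + A.1 0 2 * t0 + A.1 1 2 * t1 + A.1 2 2 * t2
      exact one_ne_zero this
    have e : (fun i => (z i : ℝ)) = g.1ᵀ *ᵥ (w 0 ⨯₃ w 1) := by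
      have hg := g.2
      rw [Matrix.det_fin_three] at hg
      ext i
      have expand : ∀ x : Fin 3 → ℝ, ∀ i, (g.1ᵀ *ᵥ x) i =
          g.1 0 i * x 0 + g.1 1 i * x 1 + g.1 2 i * x 2 := fun x i => by
        simp [Matrix.mulVec, dotProduct, Fin.sum_univ_three]
      rw [expand]
      simp only [hz, cross_apply, hwe, hγe, Fin.sum_univ_three]
      fin_cases i
      · simp
        linear_combination -((A.1 1 0 : ℝ) * A.1 2 1 - A.1 2 0 * A.1 1 1) * hg
      · simp
        linear_combination -((A.1 2 0 : ℝ) * A.1 0 1 - A.1 0 0 * A.1 2 1) * hg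
      · simp
        linear_combination -((A.1 0 0 : ℝ) * A.1 1 1 - A.1 1 0 * A.1 0 1) * hg
    have h1 := one_le_dot_self_of_int _ hz0
    rw [e] at h1
    have := sum_sq_mulVec_le g.1ᵀ (w 0 ⨯₃ w 1)
    rw [cross_dot_self] at this
    nlinarith [gramTwo_nonneg (w 0) (w 1)]
  calc K⁻¹ * K'⁻¹ ≤ (w 0 ⬝ᵥ w 0) * gramTwo (w 0) (w 1) := by
        refine mul_le_mul ?_ ?_ (by positivity) (dotProduct_self_nonneg' _)
        · rw [inv_le_iff_one_le_mul₀ hKp]; linarith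
        · rw [inv_le_iff_one_le_mul₀ hKp']; linarith
    _ = flagPotential w := rfl

theorem flagPotential_size_reduction (w v : Fin 3 → Fin 3 → ℝ) (n : ℝ) (h0 : v 0 = w 0)
    (h1 : v 1 = w 1 + n • w 0) : gramTwo (v 0) (v 1) = gramTwo (w 0) (w 1) ∧
      orthComponent (v 0) (v 1) = orthComponent (w 0) (w 1) := by
  rw [h0, h1]
  constructor
  · simp only [gramTwo, dotProduct, Fin.sum_univ_three, Pi.add_apply, Pi.smul_apply, smul_eq_mul]
    ring
  · ext i
    simp only [orthComponent, dotProduct, Fin.sum_univ_three, Pi.add_apply, Pi.sub_apply, Pi.smul_apply, smul_eq_mul]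
    ring

theorem exists_int_abs_add_mul_le (x y : ℝ) (hy : 0 < y) : ∃ n : ℤ, |x + n * y| ≤ y / 2 := by
  refine ⟨-round (x / y), ?_⟩
  have h := abs_sub_round (x / y)
  have e : x + ((-round (x / y) : ℤ) : ℝ) * y = (x / y - round (x / y)) * y := by
    push_cast; field_simp; ring
  rw [e, abs_mul, abs_of_pos hy]
  nlinarith

theorem dot_orthComponent_left (a b : Fin 3 → ℝ) : orthComponent a b ⬝ᵥ a = 0 := by
  simp only [orthComponent, dotProduct, Fin.sum_univ_three, Pi.sub_apply, Pi.smul_apply, smul_eq_mul]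
  ring

theorem dot_orthComponent_right (a b : Fin 3 → ℝ) : orthComponent a b ⬝ᵥ b = gramTwo a b := by
  simp only [gramTwo, orthComponent, dotProduct, Fin.sum_univ_three, Pi.sub_apply, Pi.smul_apply, smul_eq_mul]
  ring

/-- Every lattice has a reduced basis. -/
theorem exists_isReducedBasis (g : SL3R) : ∃ γ ∈ SL3Z, IsReducedBasis (g * γ).cols := by
  obtain ⟨ε, hε, hlow⟩ := exists_flagPotential_lower_bound g
  set S : Set ℝ := (fun γ : SL3R => flagPotential (g * γ).cols) '' SL3Z with hS
  have hSne : S.Nonempty := ⟨_, 1, SL3Z.one_mem, rfl⟩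
  have hSbdd : BddBelow S := ⟨ε, by rintro _ ⟨γ, hγ, rfl⟩; exact hlow γ hγ⟩
  have hinf : ε ≤ sInf S := le_csInf hSne (by rintro _ ⟨γ, hγ, rfl⟩; exact hlow γ hγ)
  -- Attainment of the infimum is not needed: near-minimality gives the exchange inequalities with
  -- 99/100, and 99/100 - 1/4 still exceeds the 1/2 of `IsReducedBasis`.
  obtain ⟨_, ⟨γ₀, hγ₀, rfl⟩, hγlt⟩ := exists_lt_of_csInf_lt hSne
    (show sInf S < sInf S * (100 / 99) by linarith)
  have hmin : ∀ γ ∈ SL3Z, flagPotential (g * γ₀).cols ≤ 100 / 99 * flagPotential (g * γ).cols := by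
    intro γ hγ
    have := csInf_le hSbdd ⟨γ, hγ, rfl⟩
    simp only at hγlt this
    linarith
  have hdet : ∀ γ : SL3R, (colMatrix (g * γ).cols).det = 1 := fun γ => by
    rw [SL3R.colMatrix_cols]; exact (g * γ).2
  set w := (g * γ₀).cols with hw
  obtain ⟨hd1, hd2⟩ := gram_pos_of_one_le_det (w := w) (hdet γ₀).ge
  -- size reduction
  obtain ⟨n, hn⟩ := exists_int_abs_add_mul_le (w 0 ⬝ᵥ w 1) _ hd1
  obtain ⟨b, hb⟩ := exists_int_abs_add_mul_le (orthComponent (w 0) (w 1) ⬝ᵥ w 2) _ hd2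
  -- The multiple of `w 1` is fixed first: adding a multiple of `w 0` afterwards does not change the
  -- pairing with the orthogonal component.
  obtain ⟨a, ha⟩ := exists_int_abs_add_mul_le (w 0 ⬝ᵥ (w 2 + (b : ℝ) • w 1)) _ hd1
  obtain ⟨γ₁, hγ₁, hc⟩ := SL3Z_exists_of_int !![1, n, a; 0, 1, b; 0, 0, 1]
    (by simp [Matrix.det_fin_three])
  have hγ : γ₀ * γ₁ ∈ SL3Z := SL3Z.mul_mem hγ₀ hγ₁
  set v := (g * (γ₀ * γ₁)).cols with hv
  have hv' : ∀ j, v j = ∑ k, ((!![1, n, a; 0, 1, b; 0, 0, 1] k j : ℤ) : ℝ) • w k := fun j => by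
    rw [hv, ← mul_assoc]; exact hc (g * γ₀) j
  have v0 : v 0 = w 0 := by rw [hv']; simp [Fin.sum_univ_three]
  have v1 : v 1 = w 1 + (n : ℝ) • w 0 := by rw [hv']; simp [Fin.sum_univ_three, add_comm]
  have v2 : v 2 = w 2 + (b : ℝ) • w 1 + (a : ℝ) • w 0 := by
    rw [hv']; simp [Fin.sum_univ_three]; abel
  obtain ⟨hgram, horth⟩ := flagPotential_size_reduction w v n v0 v1
  have hpot : flagPotential v = flagPotential w := by
    rw [flagPotential, flagPotential, hgram, v0]
  have r1 : |v 0 ⬝ᵥ v 1| ≤ (v 0 ⬝ᵥ v 0) / 2 := by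
    rw [v1, v0, dotProduct_add, dotProduct_smul, smul_eq_mul]; exact hn
  have r2 : |v 0 ⬝ᵥ v 2| ≤ (v 0 ⬝ᵥ v 0) / 2 := by
    rw [v2, v0, dotProduct_add (w 0) _ ((a : ℝ) • w 0), dotProduct_smul, smul_eq_mul]; exact ha
  have r3 : |orthComponent (v 0) (v 1) ⬝ᵥ v 2| ≤ gramTwo (v 0) (v 1) / 2 := by
    rw [horth, hgram, v2, dotProduct_add, dotProduct_add, dotProduct_smul, dotProduct_smul,
      dot_orthComponent_left, dot_orthComponent_right, smul_zero, add_zero, smul_eq_mul]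
    exact hb
  -- exchange of neighbours
  obtain ⟨s₁, hs₁, hc₁⟩ := SL3Z_exists_of_int !![0, -1, 0; 1, 0, 0; 0, 0, 1]
    (by simp [Matrix.det_fin_three])
  obtain ⟨s₂, hs₂, hc₂⟩ := SL3Z_exists_of_int !![1, 0, 0; 0, 0, -1; 0, 1, 0]
    (by simp [Matrix.det_fin_three])
  have hd1v : 0 < v 0 ⬝ᵥ v 0 := by rw [v0]; exact hd1
  have hd2v : 0 < gramTwo (v 0) (v 1) := by rw [hgram]; exact hd2
  -- Exchanging the first two vectors preserves their Gram determinant, so only the factor |v₀|² of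
  -- the potential changes, to |v₁|².
  have m1 : 99 / 100 * (v 0 ⬝ᵥ v 0) ≤ v 1 ⬝ᵥ v 1 := by
    have h := hmin _ (SL3Z.mul_mem hγ hs₁)
    rw [← hpot, ← mul_assoc] at h
    have e0 : (g * (γ₀ * γ₁) * s₁).cols 0 = v 1 := by rw [hc₁]; simp [Fin.sum_univ_three, hv]
    have e1 : (g * (γ₀ * γ₁) * s₁).cols 1 = -v 0 := by rw [hc₁]; simp [Fin.sum_univ_three, hv]
    have e : flagPotential (g * (γ₀ * γ₁) * s₁).cols = (v 1 ⬝ᵥ v 1) * gramTwo (v 0) (v 1) := by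
      rw [flagPotential, e0, e1, gramTwo, gramTwo]
      simp only [dotProduct, Fin.sum_univ_three, Pi.neg_apply]; ring
    rw [e, flagPotential] at h
    refine le_of_mul_le_mul_right ?_ hd2v
    linarith
  -- Exchanging the last two vectors changes only the Gram factor.
  have m2 : 99 / 100 * gramTwo (v 0) (v 1) ≤ gramTwo (v 0) (v 2) := by
    have h := hmin _ (SL3Z.mul_mem hγ hs₂)
    rw [← hpot, ← mul_assoc] at h
    have e0 : (g * (γ₀ * γ₁) * s₂).cols 0 = v 0 := by rw [hc₂]; simp [Fin.sum_univ_three, hv]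
    have e1 : (g * (γ₀ * γ₁) * s₂).cols 1 = v 2 := by rw [hc₂]; simp [Fin.sum_univ_three, hv]
    rw [flagPotential, flagPotential, e0, e1] at h
    refine le_of_mul_le_mul_left ?_ hd1v
    linarith
  refine ⟨γ₀ * γ₁, hγ, r1, r2, r3, ?_, ?_⟩
  · have : (v 0 ⬝ᵥ v 1) ^ 2 ≤ ((v 0 ⬝ᵥ v 0) / 2) ^ 2 := by
      rw [← sq_abs]; exact pow_le_pow_left₀ (abs_nonneg _) r1 2
    change (v 0 ⬝ᵥ v 0) ^ 2 / 2 ≤ gramTwo (v 0) (v 1)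
    rw [gramTwo]
    nlinarith
  · have h1 : (orthComponent (v 0) (v 1) ⬝ᵥ v 2) ^ 2 ≤ (gramTwo (v 0) (v 1) / 2) ^ 2 := by
      rw [← sq_abs]; exact pow_le_pow_left₀ (abs_nonneg _) r3 2
    have h2 := gram_mul_gram v
    change gramTwo (v 0) (v 1) ^ 2 / 2 ≤ (v 0 ⬝ᵥ v 0) * (colMatrix v).det ^ 2
    nlinarith

end

/-! ### Integrals over triples of vectors -/

/-- Only this half of Tonelli's theorem holds without measurability, so integrands assembled from
indicators need no joint measurability proof. -/
theorem lintegral_fin_three_le {X : Type*} [MeasureSpace X] [SigmaFinite (volume : Measure X)]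
    (f : (Fin 3 → X) → ENNReal) :
    ∫⁻ w, f w ≤ ∫⁻ a : X, ∫⁻ b : X, ∫⁻ c : X, f ![a, b, c] := by
  have e1 := volume_preserving_piFinSuccAbove (fun _ : Fin 3 => X) 0
  have e2 := volume_preserving_finTwoArrow X
  rw [← (e1.symm _).lintegral_comp_emb (MeasurableEquiv.measurableEmbedding _)]
  refine (lintegral_prod_le _).trans (lintegral_mono fun a => ?_)
  rw [← (e2.symm _).lintegral_comp_emb (MeasurableEquiv.measurableEmbedding _)]
  refine (lintegral_prod_le _).trans (le_of_eq ?_)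
  congr! 5 with b c
  funext i
  fin_cases i <;> rfl

theorem lintegral_mul_mul_le {f g h : ℝ → ENNReal} (hf : Measurable f) (hg : Measurable g)
    (hh : Measurable h) : ∫⁻ y : Fin 3 → ℝ, f (y 0) * g (y 1) * h (y 2) ≤
      (∫⁻ x, f x) * (∫⁻ x, g x) * ∫⁻ x, h x := by
  refine (lintegral_fin_three_le _).trans (le_of_eq ?_)
  simp only [Matrix.cons_val_zero, Matrix.cons_val_one, Matrix.cons_val]
  simp_rw [lintegral_const_mul _ hh, lintegral_mul_const _ (hg.const_mul _), lintegral_const_mul _ hg]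
  rw [lintegral_mul_const _ (hf.mul_const _), lintegral_mul_const _ hf]

theorem lintegral_comp_mulVec (A : Matrix (Fin 3) (Fin 3) ℝ) (hA : A.det ≠ 0)
    {φ : (Fin 3 → ℝ) → ENNReal} (hφ : Measurable φ) :
    ∫⁻ v, φ (A.mulVec v) = ENNReal.ofReal |A.det⁻¹| * ∫⁻ v, φ v := by
  have h := Real.map_matrix_volume_pi_eq_smul_volume_pi hA
  have hm : Measurable (Matrix.toLin' A) := (LinearMap.continuous_of_finiteDimensional _).measurable
  have := lintegral_map (μ := volume) hφ hm
  rw [h, lintegral_smul_measure] at this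
  simpa using this.symm

/-- The function `|x|^{-s}` cut off to `[-T, T]`. -/
noncomputable def truncPow (s T : ℝ) : ℝ → ENNReal :=
  (Set.Icc (-T) T).indicator fun x => ENNReal.ofReal |x| ^ (-s)

theorem measurable_truncPow (s T : ℝ) : Measurable (truncPow s T) :=
  Measurable.indicator (by fun_prop) measurableSet_Icc

theorem truncPow_of_abs_le {s T x : ℝ} (h : |x| ≤ T) :
    truncPow s T x = ENNReal.ofReal |x| ^ (-s) :=
  Set.indicator_of_mem (Set.mem_Icc.2 (abs_le.1 h)) _

theorem truncPow_zero_of_abs_le {T x : ℝ} (h : |x| ≤ T) : truncPow 0 T x = 1 := by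
  rw [truncPow_of_abs_le h]; simp

theorem lintegral_truncPow_le {s T : ℝ} (hs : s < 1) (hT : 0 ≤ T) :
    ∫⁻ x, truncPow s T x ≤ ENNReal.ofReal (2 / (1 - s) * T ^ (1 - s)) := by
  have hint : IntervalIntegrable (fun x : ℝ => x ^ (-s)) volume 0 T :=
    intervalIntegral.intervalIntegrable_rpow' (by linarith)
  have hpos : ∫⁻ x in Set.Ioc 0 T, ENNReal.ofReal |x| ^ (-s) =
      ENNReal.ofReal (T ^ (1 - s) / (1 - s)) := by
    have h1 : ∫⁻ x in Set.Ioc 0 T, ENNReal.ofReal |x| ^ (-s) =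
        ∫⁻ x in Set.Ioc 0 T, ENNReal.ofReal (x ^ (-s)) := by
      refine setLIntegral_congr_fun measurableSet_Ioc fun x hx => ?_
      rw [abs_of_pos hx.1, ENNReal.ofReal_rpow_of_pos hx.1]
    rw [h1, ← ofReal_integral_eq_lintegral_ofReal]
    · rw [← intervalIntegral.integral_of_le hT, integral_rpow (Or.inl (by linarith))]
      rw [show -s + 1 = 1 - s by ring, Real.zero_rpow (by linarith), sub_zero]
    · exact (intervalIntegrable_iff_integrableOn_Ioc_of_le hT).1 hint
    · refine (ae_restrict_iff' measurableSet_Ioc).2 (Filter.Eventually.of_forall fun x hx => ?_)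
      exact Real.rpow_nonneg hx.1.le _
  have hneg : ∫⁻ x in Set.Ico (-T) 0, ENNReal.ofReal |x| ^ (-s) =
      ENNReal.ofReal (T ^ (1 - s) / (1 - s)) := by
    rw [← hpos]
    have := (Measure.measurePreserving_neg (volume : Measure ℝ)).setLIntegral_comp_preimage_emb
      (MeasurableEquiv.neg ℝ).measurableEmbedding (fun x => ENNReal.ofReal |x| ^ (-s)) (Set.Ioc 0 T)
    rw [← this]
    simp
  have hsplit : ∫⁻ x, truncPow s T x ≤ ∫⁻ x in Set.Ico (-T) 0 ∪ Set.Ioc 0 T, ENNReal.ofReal |x| ^ (-s) := by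
    rw [truncPow, lintegral_indicator measurableSet_Icc]
    refine le_of_eq (setLIntegral_congr ?_)
    have h0 : ∀ᵐ x : ℝ, x ≠ 0 := Measure.ae_ne volume 0
    filter_upwards [h0] with x hx
    refine propext ?_
    change (x ∈ Set.Icc (-T) T) ↔ x ∈ Set.Ico (-T) 0 ∪ Set.Ioc 0 T
    simp only [Set.mem_Icc, Set.mem_union, Set.mem_Ico, Set.mem_Ioc]
    constructor
    · rintro ⟨h1, h2⟩
      rcases lt_or_gt_of_ne hx with h | h
      · exact Or.inl ⟨h1, h⟩
      · exact Or.inr ⟨h, h2⟩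
    · rintro (⟨h1, h2⟩ | ⟨h1, h2⟩)
      · exact ⟨h1, by linarith⟩
      · exact ⟨by linarith, h2⟩
  refine hsplit.trans ((lintegral_union_le _ _ _).trans (le_of_eq ?_))
  have h1s : 0 < 1 - s := by linarith
  have : 0 ≤ T ^ (1 - s) := Real.rpow_nonneg hT _
  rw [hpos, hneg, ← ENNReal.ofReal_add (by positivity) (by positivity)]
  congr 1; ring

/-- Integrals of products of one-dimensional singularities along three linear forms. -/
theorem lintegral_truncPow_mulVec_le (A : Matrix (Fin 3) (Fin 3) ℝ) (hA : A.det ≠ 0)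
    {s₀ s₁ s₂ T₀ T₁ T₂ : ℝ} (h₀ : s₀ < 1) (h₁ : s₁ < 1) (h₂ : s₂ < 1) (hT₀ : 0 ≤ T₀)
    (hT₁ : 0 ≤ T₁) (hT₂ : 0 ≤ T₂) :
    ∫⁻ v, truncPow s₀ T₀ (A.mulVec v 0) * truncPow s₁ T₁ (A.mulVec v 1) *
        truncPow s₂ T₂ (A.mulVec v 2) ≤
      ENNReal.ofReal (|A.det|⁻¹ * ((2 / (1 - s₀) * T₀ ^ (1 - s₀)) *
        (2 / (1 - s₁) * T₁ ^ (1 - s₁)) * (2 / (1 - s₂) * T₂ ^ (1 - s₂)))) := by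
  have m0 := measurable_truncPow s₀ T₀
  have m1 := measurable_truncPow s₁ T₁
  have m2 := measurable_truncPow s₂ T₂
  rw [lintegral_comp_mulVec A hA (φ := fun y => truncPow s₀ T₀ (y 0) * truncPow s₁ T₁ (y 1) *
    truncPow s₂ T₂ (y 2)) (by fun_prop)]
  have p0 : 0 < 1 - s₀ := by linarith
  have p1 : 0 < 1 - s₁ := by linarith
  have p2 : 0 < 1 - s₂ := by linarith
  have r0 := Real.rpow_nonneg hT₀ (1 - s₀)
  have r1 := Real.rpow_nonneg hT₁ (1 - s₁)
  have r2 := Real.rpow_nonneg hT₂ (1 - s₂)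
  rw [ENNReal.ofReal_mul (by positivity), abs_inv, ENNReal.ofReal_mul (by positivity),
    ENNReal.ofReal_mul (by positivity)]
  gcongr
  refine (lintegral_mul_mul_le m0 m1 m2).trans ?_
  gcongr
  · exact lintegral_truncPow_le h₀ hT₀
  · exact lintegral_truncPow_le h₁ hT₁
  · exact lintegral_truncPow_le h₂ hT₂

/-! ### Integrating out the third, second and first vector of a reduced triple -/

section
open Matrix

/-- The rows are pairwise orthogonal with squared lengths d₁, d₁d₂ and d₂, where d₁ = |a|² and d₂ is
the Gram determinant. -/
theorem det_orthogonal_frame (a b : Fin 3 → ℝ) :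
    (Matrix.of ![a, orthComponent a b, a ⨯₃ b]).det = (a ⬝ᵥ a) * gramTwo a b := by
  rw [Matrix.det_fin_three]
  simp [gramTwo, orthComponent, cross_apply, dotProduct, Fin.sum_univ_three]
  ring

/-- The volume of the set of third vectors completing `a, b` to a reduced triple. -/
theorem lintegral_third_le (a b : Fin 3 → ℝ) (hd1 : 0 < a ⬝ᵥ a) (hd2 : 0 < gramTwo a b) :
    ∫⁻ c, truncPow 0 ((a ⬝ᵥ a) / 2) (a ⬝ᵥ c) *
      truncPow 0 (gramTwo a b / 2) (orthComponent a b ⬝ᵥ c) *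
      truncPow 0 2 ((a ⨯₃ b) ⬝ᵥ c) ≤ 4 := by
  have hdet := det_orthogonal_frame a b
  have hpos : 0 < (a ⬝ᵥ a) * gramTwo a b := mul_pos hd1 hd2
  have h := lintegral_truncPow_mulVec_le (Matrix.of ![a, orthComponent a b, a ⨯₃ b])
    (by rw [hdet]; exact hpos.ne') (s₀ := 0) (s₁ := 0) (s₂ := 0) (T₀ := (a ⬝ᵥ a) / 2)
    (T₁ := gramTwo a b / 2) (T₂ := 2) one_pos one_pos one_pos (by positivity) (by positivity)
    (by positivity)
  refine h.trans ?_
  rw [hdet, abs_of_pos hpos]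
  simp only [sub_zero, Real.rpow_one]
  -- The three windows have widths d₁, d₂ and 4, and the frame has determinant d₁d₂; the quotient is
  -- 4.
  refine (ENNReal.ofReal_le_ofReal (le_of_eq (b := 16 / 4) ?_)).trans ?_
  · field_simp; norm_num
  · norm_num

/-- Linear coordinates `⟨a, v⟩` and two cross-product components, with controlled determinant. -/
theorem exists_cross_frame (a : Fin 3 → ℝ) (hd : 0 < a ⬝ᵥ a) :
    ∃ A : Matrix (Fin 3) (Fin 3) ℝ, (a ⬝ᵥ a) * √(a ⬝ᵥ a) / 2 ≤ |A.det| ∧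
      ∀ v, A *ᵥ v = ![a ⬝ᵥ v, (A *ᵥ v) 1, (A *ᵥ v) 2] ∧
        (A *ᵥ v) 1 ^ 2 + (A *ᵥ v) 2 ^ 2 ≤ gramTwo a v := by
  have aux : ∀ x : ℝ, (a ⬝ᵥ a) ≤ 3 * x ^ 2 → √(a ⬝ᵥ a) / 2 ≤ |x| := by
    intro x hx
    have : √(a ⬝ᵥ a) ≤ 2 * |x| := by
      rw [Real.sqrt_le_left (by positivity), mul_pow, sq_abs]
      nlinarith [sq_nonneg x]
    linarith
  have fin : ∀ x d : ℝ, (a ⬝ᵥ a) ≤ 3 * x ^ 2 → d = (a ⬝ᵥ a) * x →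
      (a ⬝ᵥ a) * √(a ⬝ᵥ a) / 2 ≤ |d| := by
    intro x d hx hd'
    rw [hd', abs_mul, abs_of_pos hd, mul_div_assoc]
    exact mul_le_mul_of_nonneg_left (aux x hx) hd.le
  have hs : a ⬝ᵥ a = a 0 ^ 2 + a 1 ^ 2 + a 2 ^ 2 := by
    simp only [dotProduct, Fin.sum_univ_three]; ring
  -- The largest coordinate x of `a` satisfies |a|² ≤ 3x². The two cross-product components
  -- containing x complete ⟨a, ·⟩ to a frame of determinant |a|² x.
  have hmax : a ⬝ᵥ a ≤ 3 * a 0 ^ 2 ∨ a ⬝ᵥ a ≤ 3 * a 1 ^ 2 ∨ a ⬝ᵥ a ≤ 3 * a 2 ^ 2 := by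
    by_contra! hc
    obtain ⟨h0, h1, h2⟩ := hc
    linarith
  rcases hmax with h | h | h
  · refine ⟨!![a 0, a 1, a 2; -a 1, a 0, 0; -a 2, 0, a 0], fin (a 0) _ h ?_, fun v => ⟨?_, ?_⟩⟩
    · rw [hs, Matrix.det_fin_three]; simp; ring
    · ext i; fin_cases i <;> simp [Matrix.mulVec, dotProduct, Fin.sum_univ_three]
    · rw [gramTwo_eq_cross]
      simp [Matrix.mulVec, dotProduct, Fin.sum_univ_three]
      nlinarith [sq_nonneg (a 1 * v 2 - a 2 * v 1)]
  · refine ⟨!![a 0, a 1, a 2; -a 1, a 0, 0; 0, -a 2, a 1], fin (a 1) _ h ?_, fun v => ⟨?_, ?_⟩⟩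
    · rw [hs, Matrix.det_fin_three]; simp; ring
    · ext i; fin_cases i <;> simp [Matrix.mulVec, dotProduct, Fin.sum_univ_three]
    · rw [gramTwo_eq_cross]
      simp [Matrix.mulVec, dotProduct, Fin.sum_univ_three]
      nlinarith [sq_nonneg (a 2 * v 0 - a 0 * v 2)]
  · refine ⟨!![a 0, a 1, a 2; -a 2, 0, a 0; 0, -a 2, a 1], fin (a 2) _ h ?_, fun v => ⟨?_, ?_⟩⟩
    · rw [hs, Matrix.det_fin_three]; simp; ring
    · ext i; fin_cases i <;> simp [Matrix.mulVec, dotProduct, Fin.sum_univ_three]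
    · rw [gramTwo_eq_cross]
      simp [Matrix.mulVec, dotProduct, Fin.sum_univ_three]
      nlinarith [sq_nonneg (a 0 * v 1 - a 1 * v 0)]

/-- Splits a point singularity into one-dimensional ones, each integrable for s < 1, in place of
polar coordinates. In [0, ∞] the value at 0 is ∞ for s > 0, so no positivity is required. -/
theorem rpow_neg_le_mul {s x y d : ℝ} (hs : 0 ≤ s) (h : |x| * |y| ≤ d) :
    ENNReal.ofReal d ^ (-s) ≤ ENNReal.ofReal |x| ^ (-s) * ENNReal.ofReal |y| ^ (-s) := by
  rcases hs.eq_or_lt with rfl | hs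
  · simp
  rw [← ENNReal.mul_rpow_of_ne_top ENNReal.ofReal_ne_top ENNReal.ofReal_ne_top,
    ← ENNReal.ofReal_mul (abs_nonneg _)]
  rw [ENNReal.rpow_neg, ENNReal.rpow_neg, ENNReal.inv_le_inv]
  exact ENNReal.rpow_le_rpow (ENNReal.ofReal_le_ofReal h) hs.le

/-- The integral of a power of the Gram determinant over the second vectors. -/
theorem lintegral_second_le {s : ℝ} (hs0 : 0 ≤ s) (hs1 : s < 1) (a : Fin 3 → ℝ)
    (hd : 0 < a ⬝ᵥ a) :
    ∫⁻ b in {b | |a ⬝ᵥ b| ≤ (a ⬝ᵥ a) / 2 ∧ gramTwo a b ^ 2 ≤ 8 * (a ⬝ᵥ a)},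
      ENNReal.ofReal (gramTwo a b) ^ (-s) ≤
    ENNReal.ofReal (2 * (2 / (1 - s)) ^ 2 * 8 ^ ((1 - s) / 2) * (a ⬝ᵥ a) ^ (-(s / 2))) := by
  obtain ⟨A, hA, hAv⟩ := exists_cross_frame a hd
  set d := a ⬝ᵥ a with hddef
  set T := (8 * d) ^ (1 / 4 : ℝ) with hT
  have hT0 : 0 < T := by positivity
  have hT4 : T ^ 4 = 8 * d := by
    rw [hT, ← Real.rpow_natCast, ← Real.rpow_mul (by positivity)]; norm_num
  have hApos : 0 < |A.det| := lt_of_lt_of_le (by positivity) hA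
  have hA0 : A.det ≠ 0 := abs_pos.1 hApos
  have hpt : ∀ b ∈ {b | |a ⬝ᵥ b| ≤ d / 2 ∧ gramTwo a b ^ 2 ≤ 8 * d},
      ENNReal.ofReal (gramTwo a b) ^ (-s) ≤
        truncPow 0 (d / 2) ((A *ᵥ b) 0) * truncPow s T ((A *ᵥ b) 1) *
          truncPow s T ((A *ᵥ b) 2) := by
    rintro b ⟨h1, h2⟩
    obtain ⟨e, hg⟩ := hAv b
    have e0 : (A *ᵥ b) 0 = a ⬝ᵥ b := congrFun e 0
    set x := (A *ᵥ b) 1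
    set y := (A *ᵥ b) 2
    have hgT : gramTwo a b ≤ T ^ 2 := by
      refine le_of_sq_le_sq ?_ (by positivity)
      calc _ ≤ 8 * d := h2
        _ = (T ^ 2) ^ 2 := by rw [← hT4]; ring
    have hx : |x| ≤ T := abs_le_of_sq_le_sq (by nlinarith [sq_nonneg y]) hT0.le
    have hy : |y| ≤ T := abs_le_of_sq_le_sq (by nlinarith [sq_nonneg x]) hT0.le
    rw [e0, truncPow_zero_of_abs_le h1, truncPow_of_abs_le hx, truncPow_of_abs_le hy, one_mul]
    refine rpow_neg_le_mul hs0 (le_trans ?_ hg)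
    rw [← sq_abs x, ← sq_abs y]
    nlinarith [sq_nonneg (|x| - |y|), sq_nonneg (|x|), sq_nonneg (|y|)]
  refine (setLIntegral_mono' ?_ hpt).trans ((setLIntegral_le_lintegral _ _).trans
    ((lintegral_truncPow_mulVec_le A hA0 one_pos hs1 hs1 (by positivity) hT0.le hT0.le).trans ?_))
  · have c1 : Continuous fun b : Fin 3 → ℝ => a ⬝ᵥ b := by
      simp only [dotProduct]; fun_prop
    have c2 : Continuous fun b : Fin 3 → ℝ => gramTwo a b := by
      simp only [gramTwo, dotProduct]; fun_prop
    exact ((isClosed_le c1.abs continuous_const).inter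
      (isClosed_le (c2.pow 2) continuous_const)).measurableSet
  refine ENNReal.ofReal_le_ofReal ?_
  have h1s : 0 < 1 - s := by linarith
  -- Powers of d: the first window gives 1, the other two together (1 - s)/2, the determinant -3/2;
  -- the total is -s/2.
  have hTT : T ^ (1 - s) * T ^ (1 - s) = 8 ^ ((1 - s) / 2) * d ^ ((1 - s) / 2) := by
    rw [hT, ← Real.rpow_mul (by positivity), ← Real.rpow_add (by positivity),
      ← Real.mul_rpow (by norm_num) hd.le]
    congr 1; ring
  have hdd : d ^ ((1 - s) / 2) = √d * d ^ (-(s / 2)) := by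
    rw [Real.sqrt_eq_rpow, ← Real.rpow_add hd]; congr 1; ring
  have hsd : 0 < √d := Real.sqrt_pos.2 hd
  have hinv : |A.det|⁻¹ ≤ (d * √d / 2)⁻¹ := inv_anti₀ (by positivity) hA
  calc _ = |A.det|⁻¹ * (d * (2 / (1 - s)) ^ 2 * (T ^ (1 - s) * T ^ (1 - s))) := by
        simp only [sub_zero, Real.rpow_one]; ring
    _ ≤ (d * √d / 2)⁻¹ * (d * (2 / (1 - s)) ^ 2 * (T ^ (1 - s) * T ^ (1 - s))) := by
        gcongr
    _ = _ := by
        rw [hTT, hdd]; field_simp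

/-- The integral of a power of the length over the first vectors. -/
theorem lintegral_first_lt_top {s : ℝ} (hs0 : 0 ≤ s) (hs1 : s < 1) :
    ∫⁻ a in {a : Fin 3 → ℝ | 0 < a ⬝ᵥ a ∧ a ⬝ᵥ a ≤ 4},
      ENNReal.ofReal ((a ⬝ᵥ a) ^ (-(3 * s / 2))) < ⊤ := by
  have hm : MeasurableSet {a : Fin 3 → ℝ | 0 < a ⬝ᵥ a ∧ a ⬝ᵥ a ≤ 4} := by
    have c1 : Continuous fun a : Fin 3 → ℝ => a ⬝ᵥ a := by
      simp only [dotProduct]; fun_prop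
    exact (isOpen_lt continuous_const c1).measurableSet.inter
      (isClosed_le c1 continuous_const).measurableSet
  have hpt : ∀ a ∈ {a : Fin 3 → ℝ | 0 < a ⬝ᵥ a ∧ a ⬝ᵥ a ≤ 4},
      ENNReal.ofReal ((a ⬝ᵥ a) ^ (-(3 * s / 2))) ≤
        truncPow s 2 (((1 : Matrix (Fin 3) (Fin 3) ℝ) *ᵥ a) 0) *
        truncPow s 2 (((1 : Matrix (Fin 3) (Fin 3) ℝ) *ᵥ a) 1) *
        truncPow s 2 (((1 : Matrix (Fin 3) (Fin 3) ℝ) *ᵥ a) 2) := by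
    rintro a ⟨h0, h4⟩
    rw [Matrix.one_mulVec]
    have hs : a ⬝ᵥ a = a 0 ^ 2 + a 1 ^ 2 + a 2 ^ 2 := by
      simp only [dotProduct, Fin.sum_univ_three]; ring
    have q0 := sq_nonneg (a 0)
    have q1 := sq_nonneg (a 1)
    have q2 := sq_nonneg (a 2)
    have hx : ∀ i, |a i| ≤ 2 := by
      intro i
      refine abs_le_of_sq_le_sq ?_ (by norm_num)
      fin_cases i <;> simp <;> linarith
    rw [truncPow_of_abs_le (hx 0), truncPow_of_abs_le (hx 1), truncPow_of_abs_le (hx 2)]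
    set d := a ⬝ᵥ a
    -- d^(3/2) dominates |a₀a₁a₂|, so the radial singularity is bounded by a product of coordinate
    -- singularities of exponent s < 1.
    have e : d ^ (-(3 * s / 2)) = (d ^ (3 / 2 : ℝ)) ^ (-s) := by
      rw [← Real.rpow_mul h0.le]; congr 1; ring
    rw [e, ← ENNReal.ofReal_rpow_of_pos (by positivity)]
    refine (rpow_neg_le_mul (x := |a 0| * |a 1|) (y := a 2) hs0 ?_).trans ?_
    · refine le_of_sq_le_sq ?_ (by positivity)
      have : (d ^ (3 / 2 : ℝ)) ^ 2 = d ^ 3 := by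
        rw [← Real.rpow_natCast, ← Real.rpow_mul h0.le, ← Real.rpow_natCast]; norm_num
      rw [this, mul_pow, sq_abs, sq_abs, mul_pow, sq_abs, sq_abs]
      calc a 0 ^ 2 * a 1 ^ 2 * a 2 ^ 2 ≤ d * d * d := by
            gcongr <;> linarith
        _ = d ^ 3 := by ring
    · gcongr
      exact rpow_neg_le_mul hs0 (by rw [abs_mul, abs_abs, abs_abs])
  refine ((setLIntegral_mono' hm hpt).trans ((setLIntegral_le_lintegral _ _).trans
    (lintegral_truncPow_mulVec_le 1 (by simp) hs1 hs1 hs1 zero_le_two zero_le_two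
      zero_le_two))).trans_lt ENNReal.ofReal_lt_top

/-- The set of reduced triples with determinant between `1` and `2`. -/
def reducedSet : Set (Fin 3 → Fin 3 → ℝ) :=
  {w | IsReducedBasis w ∧ 1 ≤ (colMatrix w).det ∧ (colMatrix w).det ≤ 2}

theorem continuous_colMatrix_det : Continuous fun w : Fin 3 → Fin 3 → ℝ => (colMatrix w).det := by
  simp only [colMatrix_det]; fun_prop

theorem measurableSet_isReducedBasis : MeasurableSet {w | IsReducedBasis w} := by
  have c1 : ∀ i j, Continuous fun w : Fin 3 → Fin 3 → ℝ => w i ⬝ᵥ w j := fun i j => by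
    simp only [dotProduct]; fun_prop
  have c2 : Continuous fun w : Fin 3 → Fin 3 → ℝ => gramTwo (w 0) (w 1) :=
    ((c1 0 0).mul (c1 1 1)).sub ((c1 0 1).pow 2)
  have c3 : Continuous fun w : Fin 3 → Fin 3 → ℝ => orthComponent (w 0) (w 1) ⬝ᵥ w 2 := by
    simp only [orthComponent, dotProduct, Pi.sub_apply, Pi.smul_apply, smul_eq_mul]; fun_prop
  have e : {w | IsReducedBasis w} =
      {w | |w 0 ⬝ᵥ w 1| ≤ (w 0 ⬝ᵥ w 0) / 2} ∩ ({w | |w 0 ⬝ᵥ w 2| ≤ (w 0 ⬝ᵥ w 0) / 2} ∩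
      ({w | |orthComponent (w 0) (w 1) ⬝ᵥ w 2| ≤ gramTwo (w 0) (w 1) / 2} ∩
      ({w | (w 0 ⬝ᵥ w 0) ^ 2 / 2 ≤ gramTwo (w 0) (w 1)} ∩
      {w | gramTwo (w 0) (w 1) ^ 2 / 2 ≤ (w 0 ⬝ᵥ w 0) * (colMatrix w).det ^ 2}))) := by
    ext w
    exact ⟨fun h => ⟨h.1, h.2, h.3, h.4, h.5⟩, fun ⟨h1, h2, h3, h4, h5⟩ => ⟨h1, h2, h3, h4, h5⟩⟩
  rw [e]
  refine MeasurableSet.inter ?_ (MeasurableSet.inter ?_ (MeasurableSet.inter ?_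
    (MeasurableSet.inter ?_ ?_)))
  · exact (isClosed_le (c1 0 1).abs ((c1 0 0).div_const 2)).measurableSet
  · exact (isClosed_le (c1 0 2).abs ((c1 0 0).div_const 2)).measurableSet
  · exact (isClosed_le c3.abs (c2.div_const 2)).measurableSet
  · exact (isClosed_le (((c1 0 0).pow 2).div_const 2) c2).measurableSet
  · exact (isClosed_le ((c2.pow 2).div_const 2)
      ((c1 0 0).mul (continuous_colMatrix_det.pow 2))).measurableSet

theorem measurableSet_reducedSet : MeasurableSet reducedSet :=
  measurableSet_isReducedBasis.inter
    ((isClosed_le continuous_const continuous_colMatrix_det).measurableSet.inter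
      (isClosed_le continuous_colMatrix_det continuous_const).measurableSet)

/-- The third vector costs a factor 4, the second turns d₂^(-s) into a multiple of d₁^(-s/2), and
d₁^(-3s/2) remains on a ball. This is where p < 3 enters, as s < 1. -/
theorem lintegral_flagPotential_lt_top {p : ℝ} (hp0 : 0 ≤ p) (hp3 : p < 3) :
    ∫⁻ w in reducedSet, ENNReal.ofReal (flagPotential w) ^ (-(p / 3)) < ⊤ := by
  set s := p / 3 with hs
  have hs0 : 0 ≤ s := by positivity
  have hs1 : s < 1 := by rw [hs]; linarith
  let S₁ : Set (Fin 3 → ℝ) := {a | 0 < a ⬝ᵥ a ∧ a ⬝ᵥ a ≤ 4}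
  let S₂ : (Fin 3 → ℝ) → Set (Fin 3 → ℝ) := fun a =>
    {b | |a ⬝ᵥ b| ≤ (a ⬝ᵥ a) / 2 ∧ gramTwo a b ^ 2 ≤ 8 * (a ⬝ᵥ a)}
  let H : (Fin 3 → Fin 3 → ℝ) → ENNReal := fun w =>
    S₁.indicator (fun a => ENNReal.ofReal (a ⬝ᵥ a) ^ (-s)) (w 0) *
    ((S₂ (w 0) ∩ {b | 0 < gramTwo (w 0) b}).indicator
        (fun b => ENNReal.ofReal (gramTwo (w 0) b) ^ (-s)) (w 1) *
      (truncPow 0 ((w 0 ⬝ᵥ w 0) / 2) (w 0 ⬝ᵥ w 2) *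
        truncPow 0 (gramTwo (w 0) (w 1) / 2) (orthComponent (w 0) (w 1) ⬝ᵥ w 2) *
        truncPow 0 2 ((w 0 ⨯₃ w 1) ⬝ᵥ w 2)))
  have hpt : ∀ w ∈ reducedSet, ENNReal.ofReal (flagPotential w) ^ (-s) ≤ H w := by
    rintro w ⟨hw, hD1, hD2⟩
    obtain ⟨hd1, hd2⟩ := gram_pos_of_one_le_det hD1
    have g1 := hw.sq_le_gram
    -- `gram_sq_le` with determinant at most 2 gives d₂² ≤ 8d₁. Combined with d₁² ≤ 2d₂ this yields
    -- d₁³ ≤ 32, whence the bound 4 in `S₁`.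
    have g2 : gramTwo (w 0) (w 1) ^ 2 ≤ 8 * (w 0 ⬝ᵥ w 0) := by
      have := hw.gram_sq_le
      have : (colMatrix w).det ^ 2 ≤ 4 := by nlinarith
      nlinarith
    have hS₁ : w 0 ∈ S₁ := by
      refine ⟨hd1, ?_⟩
      by_contra hc
      push Not at hc
      set x := w 0 ⬝ᵥ w 0
      have : (x ^ 2 / 2) ^ 2 ≤ gramTwo (w 0) (w 1) ^ 2 := pow_le_pow_left₀ (by positivity) g1 2
      have h3 : (64 : ℝ) < x ^ 3 := by
        calc (64 : ℝ) = 4 ^ 3 := by norm_num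
          _ < x ^ 3 := pow_lt_pow_left₀ hc (by norm_num) (by norm_num)
      nlinarith
    have hS₂ : w 1 ∈ S₂ (w 0) ∩ {b | 0 < gramTwo (w 0) b} := ⟨⟨hw.abs_dot_one, g2⟩, hd2⟩
    have hn : |(w 0 ⨯₃ w 1) ⬝ᵥ w 2| ≤ 2 := by
      have e : (w 0 ⨯₃ w 1) ⬝ᵥ w 2 = (colMatrix w).det := by
        simp only [colMatrix_det, cross_apply, dotProduct, Fin.sum_univ_three]
        simp; ring
      rw [e, abs_le]; constructor <;> linarith
    simp only [H]
    rw [Set.indicator_of_mem hS₁, Set.indicator_of_mem hS₂,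
      truncPow_zero_of_abs_le hw.abs_dot_two, truncPow_zero_of_abs_le hw.abs_orth_two,
      truncPow_zero_of_abs_le hn, mul_one, mul_one, mul_one,
      ← ENNReal.mul_rpow_of_ne_top ENNReal.ofReal_ne_top ENNReal.ofReal_ne_top,
      ← ENNReal.ofReal_mul hd1.le]
    rfl
  have hS₁m : MeasurableSet S₁ := by
    have c1 : Continuous fun a : Fin 3 → ℝ => a ⬝ᵥ a := by
      simp only [dotProduct]; fun_prop
    exact (isOpen_lt continuous_const c1).measurableSet.inter
      (isClosed_le c1 continuous_const).measurableSet
  have hS₂m : ∀ a, MeasurableSet (S₂ a) := fun a => by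
    have c1 : Continuous fun b : Fin 3 → ℝ => a ⬝ᵥ b := by
      simp only [dotProduct]; fun_prop
    have c2 : Continuous fun b : Fin 3 → ℝ => gramTwo a b := by
      simp only [gramTwo, dotProduct]; fun_prop
    exact ((isClosed_le c1.abs continuous_const).inter
      (isClosed_le (c2.pow 2) continuous_const)).measurableSet
  set K : ℝ := 2 * (2 / (1 - s)) ^ 2 * 8 ^ ((1 - s) / 2) with hK
  have hK0 : 0 ≤ K := by positivity
  have inner : ∀ a b : Fin 3 → ℝ, a ∈ S₁ → ∫⁻ c, H ![a, b, c] ≤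
      ENNReal.ofReal (a ⬝ᵥ a) ^ (-s) *
        ((S₂ a).indicator (fun b => ENNReal.ofReal (gramTwo a b) ^ (-s)) b * 4) := by
    intro a b ha
    simp only [H, Matrix.cons_val_zero, Matrix.cons_val_one, Matrix.cons_val]
    rw [Set.indicator_of_mem ha]
    have mt : ∀ T, Measurable (truncPow 0 T) := measurable_truncPow 0
    have md : ∀ x : Fin 3 → ℝ, Measurable fun c : Fin 3 → ℝ => x ⬝ᵥ c := fun x => by
      simp only [dotProduct]; fun_prop
    have hmeas : Measurable fun c : Fin 3 → ℝ => truncPow 0 ((a ⬝ᵥ a) / 2) (a ⬝ᵥ c) *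
        truncPow 0 (gramTwo a b / 2) (orthComponent a b ⬝ᵥ c) *
        truncPow 0 2 ((a ⨯₃ b) ⬝ᵥ c) :=
      (((mt _).comp (md _)).mul ((mt _).comp (md _))).mul ((mt _).comp (md _))
    rw [lintegral_const_mul _ (hmeas.const_mul _), lintegral_const_mul _ hmeas]
    refine mul_le_mul' le_rfl ?_
    by_cases hb : b ∈ S₂ a ∩ {b | 0 < gramTwo a b}
    · rw [Set.indicator_of_mem hb, Set.indicator_of_mem hb.1]
      gcongr
      exact lintegral_third_le a b ha.1 hb.2
    · rw [Set.indicator_of_notMem hb]; simp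
  have middle : ∀ a : Fin 3 → ℝ, ∫⁻ b, ∫⁻ c, H ![a, b, c] ≤
      S₁.indicator (fun a => ENNReal.ofReal (4 * K) *
        ENNReal.ofReal ((a ⬝ᵥ a) ^ (-(3 * s / 2)))) a := by
    intro a
    by_cases ha : a ∈ S₁
    · rw [Set.indicator_of_mem ha]
      have hd : 0 < a ⬝ᵥ a := ha.1
      have mg : Measurable fun b : Fin 3 → ℝ => ENNReal.ofReal (gramTwo a b) ^ (-s) := by
        simp only [gramTwo, dotProduct]; fun_prop
      have mi := mg.indicator (hS₂m a)
      refine (lintegral_mono fun b => inner a b ha).trans ?_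
      rw [lintegral_const_mul _ (mi.mul_const _), lintegral_mul_const _ mi,
        lintegral_indicator (hS₂m a)]
      calc _ ≤ ENNReal.ofReal (a ⬝ᵥ a) ^ (-s) *
            (ENNReal.ofReal (K * (a ⬝ᵥ a) ^ (-(s / 2))) * 4) := by
            gcongr
            exact lintegral_second_le hs0 hs1 a hd
        _ = _ := by
            rw [ENNReal.ofReal_rpow_of_pos hd, show (4 : ENNReal) = ENNReal.ofReal 4 by norm_num,
              ← ENNReal.ofReal_mul (by positivity), ← ENNReal.ofReal_mul (by positivity),
              ← ENNReal.ofReal_mul (by positivity)]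
            congr 1
            rw [show -(3 * s / 2) = -s + -(s / 2) by ring, Real.rpow_add hd]
            ring
    · rw [Set.indicator_of_notMem ha]
      refine le_of_eq ?_
      simp only [H, Matrix.cons_val_zero]
      rw [Set.indicator_of_notMem ha]
      simp
  have step : ∫⁻ w in reducedSet, ENNReal.ofReal (flagPotential w) ^ (-s) ≤ ∫⁻ w, H w := by
    rw [← lintegral_indicator measurableSet_reducedSet]
    refine lintegral_mono fun w => ?_
    by_cases hw : w ∈ reducedSet
    · rw [Set.indicator_of_mem hw]; exact hpt w hw
    · rw [Set.indicator_of_notMem hw]; exact zero_le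
  refine step.trans_lt (((lintegral_fin_three_le H).trans (lintegral_mono middle)).trans_lt ?_)
  rw [lintegral_indicator hS₁m, lintegral_const_mul']
  · exact ENNReal.mul_lt_top ENNReal.ofReal_lt_top (lintegral_first_lt_top hs0 hs1)
  · exact ENNReal.ofReal_ne_top

end

/-! ### Haar measure on `SL₃(ℝ)` as a cone measure -/

section
open Matrix

theorem measurePreserving_mulVec (h : SL3R) :
    MeasurePreserving (fun v : Fin 3 → ℝ => h.1 *ᵥ v) volume volume := by
  have hdet : h.1.det = 1 := h.2
  have := Real.map_matrix_volume_pi_eq_smul_volume_pi (M := h.1) (by rw [hdet]; exact one_ne_zero)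
  rw [hdet, inv_one, abs_one, ENNReal.ofReal_one, one_smul] at this
  exact ⟨(LinearMap.continuous_of_finiteDimensional (Matrix.toLin' h.1)).measurable, this⟩

theorem measurePreserving_mulVec_pi (h : SL3R) :
    MeasurePreserving (fun (w : Fin 3 → Fin 3 → ℝ) j => h.1 *ᵥ w j) volume volume :=
  volume_preserving_pi fun _ => measurePreserving_mulVec h

/-- Transposition is a linear involution, so its determinant has modulus 1. -/
theorem measurePreserving_swap_args :
    MeasurePreserving (fun (w : Fin 3 → Fin 3 → ℝ) i j => w j i) volume volume := by
  let T : (Fin 3 → Fin 3 → ℝ) →ₗ[ℝ] (Fin 3 → Fin 3 → ℝ) :=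
    { toFun := fun w i j => w j i
      map_add' := fun _ _ => rfl
      map_smul' := fun _ _ => rfl }
  have hT : T * T = 1 := rfl
  have hdet : LinearMap.det T * LinearMap.det T = 1 := by rw [← map_mul, hT, map_one]
  have habs : |(LinearMap.det T)⁻¹| = 1 := by
    have h1 : |LinearMap.det T| * |LinearMap.det T| = 1 := by rw [← abs_mul, hdet, abs_one]
    rw [abs_inv, show |LinearMap.det T| = 1 by nlinarith [abs_nonneg (LinearMap.det T)], inv_one]
  have := Measure.map_linearMap_addHaar_eq_smul_addHaar
    (volume : Measure (Fin 3 → Fin 3 → ℝ)) (f := T) (left_ne_zero_of_mul_eq_one hdet)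
  rw [habs, ENNReal.ofReal_one, one_smul] at this
  exact ⟨(LinearMap.continuous_of_finiteDimensional T).measurable, this⟩

/-- Right multiplication by `h` is left multiplication by its transpose, conjugated by
transposition. -/
theorem measurePreserving_mul_right_pi (h : SL3R) :
    MeasurePreserving (fun (w : Fin 3 → Fin 3 → ℝ) j i => (h.1ᵀ *ᵥ fun k => w k i) j)
      volume volume := by
  have hT : (h.1ᵀ).det = 1 := by rw [Matrix.det_transpose]; exact h.2
  exact measurePreserving_swap_args.comp
    ((measurePreserving_mulVec_pi ⟨h.1ᵀ, hT⟩).comp measurePreserving_swap_args)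

theorem det_normalize {w : Fin 3 → Fin 3 → ℝ} (h : 0 < (colMatrix w).det) :
    ((colMatrix w).det ^ (-(1 / 3) : ℝ) • colMatrix w).det = 1 := by
  rw [Matrix.det_smul, Fintype.card_fin, ← Real.rpow_natCast, ← Real.rpow_mul h.le]
  norm_num
  rw [Real.rpow_neg_one, inv_mul_cancel₀ h.ne']

open Classical in
/-- The radial projection of matrices with positive determinant to `SL₃(ℝ)`. -/
noncomputable def coneMap (w : Fin 3 → Fin 3 → ℝ) : SL3R :=
  if h : 0 < (colMatrix w).det then ⟨_, det_normalize h⟩ else 1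

theorem coneMap_val {w : Fin 3 → Fin 3 → ℝ} (h : 0 < (colMatrix w).det) :
    (coneMap w).1 = (colMatrix w).det ^ (-(1 / 3) : ℝ) • colMatrix w := by
  have e : coneMap w = ⟨_, det_normalize h⟩ := dif_pos h
  rw [e]

theorem coneMap_of_not_pos {w : Fin 3 → Fin 3 → ℝ} (h : ¬ 0 < (colMatrix w).det) :
    coneMap w = 1 :=
  dif_neg h

theorem coneMap_cols {w : Fin 3 → Fin 3 → ℝ} (h : 0 < (colMatrix w).det) :
    (coneMap w).cols = (colMatrix w).det ^ (-(1 / 3) : ℝ) • w := by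
  ext j i
  simp only [SL3R.cols, coneMap_val h]
  rfl

theorem measurable_coneMap : Measurable coneMap := by
  classical
  have hU : IsOpen {w : Fin 3 → Fin 3 → ℝ | 0 < (colMatrix w).det} :=
    isOpen_lt continuous_const continuous_colMatrix_det
  have h1 : ContinuousOn coneMap {w : Fin 3 → Fin 3 → ℝ | 0 < (colMatrix w).det} := by
    refine (Matrix.SpecialLinearGroup.isClosedEmbedding_val (n := Fin 3)
      (R := ℝ)).isInducing.continuousOn_iff.2 ?_
    have hc : Continuous colMatrix := by
      refine continuous_matrix fun i j => ?_
      simp only [colMatrix, Matrix.of_apply]; fun_prop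
    refine ContinuousOn.congr (f := fun w => (colMatrix w).det ^ (-(1 / 3) : ℝ) • colMatrix w) ?_
      fun w hw => coneMap_val hw
    exact (continuous_colMatrix_det.continuousOn.rpow_const
      fun w hw => Or.inl (ne_of_gt hw)).smul hc.continuousOn
  have h2 : ContinuousOn coneMap {w : Fin 3 → Fin 3 → ℝ | 0 < (colMatrix w).det}ᶜ := by
    refine ContinuousOn.congr (f := fun _ => 1) continuousOn_const fun w hw => ?_
    exact coneMap_of_not_pos hw
  simpa using ContinuousOn.measurable_piecewise h1 h2 hU.measurableSet

/-- The triples of determinant between `1` and `2`. -/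
def detSlab : Set (Fin 3 → Fin 3 → ℝ) := {w | 1 ≤ (colMatrix w).det ∧ (colMatrix w).det ≤ 2}

theorem measurableSet_detSlab : MeasurableSet detSlab :=
  (isClosed_le continuous_const continuous_colMatrix_det).measurableSet.inter
    (isClosed_le continuous_colMatrix_det continuous_const).measurableSet

/-- The image on `SL₃(ℝ)` of Lebesgue measure on matrices of determinant between `1` and `2`. -/
noncomputable def coneMeasure : Measure SL3R := (volume.restrict detSlab).map coneMap

/-- A map preserving volume and determinant preserves Lebesgue measure on the slab; equivariance of
the radial projection pushes this down to the group. Both one-sided invariances follow. -/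
theorem map_coneMeasure {T : (Fin 3 → Fin 3 → ℝ) → Fin 3 → Fin 3 → ℝ} {τ : SL3R → SL3R}
    (hT : MeasurePreserving T volume volume) (hτ : Measurable τ)
    (hdet : ∀ w, (colMatrix (T w)).det = (colMatrix w).det)
    (hcomm : ∀ w, 0 < (colMatrix w).det → coneMap (T w) = τ (coneMap w)) :
    coneMeasure.map τ = coneMeasure := by
  have hpre : T ⁻¹' detSlab = detSlab := by
    ext w; simp only [detSlab, Set.mem_preimage, Set.mem_ofPred_eq, hdet]
  have hT' := hT.restrict_preimage measurableSet_detSlab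
  rw [hpre] at hT'
  rw [coneMeasure, Measure.map_map hτ measurable_coneMap]
  conv_rhs => rw [← hT'.map_eq, Measure.map_map measurable_coneMap hT.measurable]
  refine Measure.map_congr ((ae_restrict_iff' measurableSet_detSlab).2
    (Filter.Eventually.of_forall fun w hw => (hcomm w (lt_of_lt_of_le one_pos hw.1)).symm))

theorem coneMap_eq_of_colMatrix {w w' : Fin 3 → Fin 3 → ℝ} (h : 0 < (colMatrix w).det) {g : SL3R}
    (hd : (colMatrix w').det = (colMatrix w).det)
    (hg : g.1 = (colMatrix w).det ^ (-(1 / 3) : ℝ) • colMatrix w') : coneMap w' = g := by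
  refine Subtype.ext ?_
  rw [coneMap_val (by rw [hd]; exact h), hd, hg]

instance : coneMeasure.IsMulLeftInvariant := by
  refine ⟨fun h => ?_⟩
  have hcol : ∀ w, colMatrix (fun j => h.1 *ᵥ w j) = h.1 * colMatrix w := fun w => by
    ext i j
    simp [colMatrix, Matrix.mulVec, dotProduct, Matrix.mul_apply]
  have hdet : ∀ w, (colMatrix fun j => h.1 *ᵥ w j).det = (colMatrix w).det := fun w => by
    rw [hcol, Matrix.det_mul, h.2, one_mul]
  refine map_coneMeasure (measurePreserving_mulVec_pi h) (measurable_const_mul h) hdet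
    fun w hw => coneMap_eq_of_colMatrix hw (hdet w) ?_
  rw [Matrix.SpecialLinearGroup.coe_mul, coneMap_val hw, hcol, Matrix.mul_smul]

instance : coneMeasure.IsMulRightInvariant := by
  refine ⟨fun h => ?_⟩
  have hcol : ∀ w, colMatrix (fun j i => (h.1ᵀ *ᵥ fun k => w k i) j) = colMatrix w * h.1 :=
    fun w => by
      ext i j
      simp [colMatrix, Matrix.mulVec, dotProduct, Matrix.mul_apply, mul_comm]
  have hdet : ∀ w, (colMatrix fun j i => (h.1ᵀ *ᵥ fun k => w k i) j).det = (colMatrix w).det :=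
    fun w => by rw [hcol, Matrix.det_mul, h.2, mul_one]
  refine map_coneMeasure (measurePreserving_mul_right_pi h) (measurable_mul_const h) hdet
    fun w hw => coneMap_eq_of_colMatrix hw (hdet w) ?_
  rw [Matrix.SpecialLinearGroup.coe_mul, coneMap_val hw, hcol, Matrix.smul_mul]

/-- On the slab the projection scales by a factor of at least 1/2, so the part of the slab over a
compact set is bounded. -/
instance : IsFiniteMeasureOnCompacts coneMeasure := by
  refine ⟨fun K hK => ?_⟩
  have hb : ∀ i j : Fin 3, ∃ C, ∀ g ∈ K, |g.1 i j| ≤ C := fun i j => by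
    have hc : Continuous fun g : SL3R => g.1 i j :=
      (continuous_apply j).comp ((continuous_apply i).comp continuous_subtype_val)
    obtain ⟨C, hC⟩ := hK.exists_bound_of_continuousOn hc.continuousOn
    exact ⟨C, hC⟩
  choose C hC using hb
  rw [coneMeasure, Measure.map_apply measurable_coneMap hK.measurableSet,
    Measure.restrict_apply (measurable_coneMap hK.measurableSet)]
  have hsub : coneMap ⁻¹' K ∩ detSlab ⊆
      Set.pi Set.univ fun j => Set.pi Set.univ fun i => Set.Icc (-(2 * C i j)) (2 * C i j) := by
    rintro w ⟨hwK, hw1, hw2⟩ j - i -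
    have h0 : 0 < (colMatrix w).det := by linarith
    have h := hC i j _ hwK
    rw [coneMap_val h0] at h
    have hD : (1 / 2 : ℝ) ≤ (colMatrix w).det ^ (-(1 / 3) : ℝ) := by
      rw [Real.rpow_neg h0.le, one_div]
      refine inv_anti₀ (by positivity) ?_
      calc (colMatrix w).det ^ (1 / 3 : ℝ) ≤ (colMatrix w).det ^ (1 : ℝ) :=
            Real.rpow_le_rpow_of_exponent_le hw1 (by norm_num)
        _ ≤ 2 := by rw [Real.rpow_one]; exact hw2
    have e : (((colMatrix w).det ^ (-(1 / 3) : ℝ) • colMatrix w : Matrix _ _ ℝ) i j) =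
        (colMatrix w).det ^ (-(1 / 3) : ℝ) * w j i := rfl
    rw [e, abs_mul, abs_of_pos (by linarith)] at h
    have : |w j i| ≤ 2 * C i j := by nlinarith [abs_nonneg (w j i)]
    exact abs_le.1 this
  refine (measure_mono hsub).trans_lt ?_
  have hcomp : IsCompact (Set.pi Set.univ fun j : Fin 3 => Set.pi Set.univ fun i : Fin 3 =>
      Set.Icc (-(2 * C i j)) (2 * C i j)) :=
    isCompact_univ_pi fun _ => isCompact_univ_pi fun _ => isCompact_Icc
  exact hcomp.measure_lt_top

theorem coneMeasure_ne_zero : coneMeasure ≠ 0 := by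
  intro h
  have h1 : coneMeasure Set.univ = 0 := by rw [h]; rfl
  rw [coneMeasure, Measure.map_apply measurable_coneMap MeasurableSet.univ, Set.preimage_univ,
    Measure.restrict_apply MeasurableSet.univ, Set.univ_inter] at h1
  have hO : IsOpen {w : Fin 3 → Fin 3 → ℝ | 1 < (colMatrix w).det ∧ (colMatrix w).det < 2} :=
    (isOpen_lt continuous_const continuous_colMatrix_det).inter
      (isOpen_lt continuous_colMatrix_det continuous_const)
  have hne : {w : Fin 3 → Fin 3 → ℝ | 1 < (colMatrix w).det ∧ (colMatrix w).det < 2}.Nonempty := by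
    refine ⟨![![3 / 2, 0, 0], ![0, 1, 0], ![0, 0, 1]], ?_⟩
    simp only [Set.mem_ofPred_eq, colMatrix_det]
    simp
    norm_num
  exact (hO.measure_pos volume hne).ne'
    (measure_mono_null (fun w (hw : 1 < (colMatrix w).det ∧ (colMatrix w).det < 2) =>
      (⟨hw.1.le, hw.2.le⟩ : w ∈ detSlab)) h1)

/-- Haar measure on `SL₃(ℝ)` is a multiple of the cone measure. -/
theorem exists_coneMeasure_eq_smul_haar : ∃ κ : NNReal, κ ≠ 0 ∧
    coneMeasure = κ • (Measure.haar : Measure SL3R) := by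
  have h := Measure.isMulLeftInvariant_eq_smul coneMeasure (Measure.haar : Measure SL3R)
  refine ⟨_, fun h0 => coneMeasure_ne_zero ?_, h⟩
  rw [h, h0, zero_smul]

end

/-! ### Comparing fundamental sets -/

/-- Integrals of `Γ`-invariant functions over a set of representatives are at most those over any
set meeting every coset. -/
theorem setLIntegral_le_of_forall_exists_mul_mem {G : Type*} [Group G] [MeasurableSpace G]
    [MeasurableMul₂ G] (m : Measure G) [m.IsMulRightInvariant] (Γ : Subgroup G) [Countable Γ]
    {F S : Set G} (hF : MeasurableSet F) (hS : MeasurableSet S)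
    (hFinj : ∀ g ∈ F, ∀ γ ∈ Γ, g * γ ∈ F → γ = 1) (hSall : ∀ g, ∃ γ ∈ Γ, g * γ ∈ S)
    {φ : G → ENNReal} (hφ : Measurable φ) (hφΓ : ∀ g, ∀ γ ∈ Γ, φ (g * γ) = φ g) :
    ∫⁻ g in F, φ g ∂m ≤ ∫⁻ g in S, φ g ∂m := by
  classical
  have hpre : ∀ γ : G, MeasurableSet ((fun g => g * γ) ⁻¹' F) := fun γ =>
    measurable_mul_const γ hF
  have hpre' : ∀ γ : G, MeasurableSet ((fun g => g * γ) ⁻¹' S) := fun γ =>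
    measurable_mul_const γ hS
  have hsub : F ⊆ ⋃ γ : Γ, F ∩ (fun g => g * (γ : G)) ⁻¹' S := fun g hg => by
    obtain ⟨γ, hγ, h⟩ := hSall g
    exact Set.mem_iUnion.2 ⟨⟨γ, hγ⟩, hg, h⟩
  -- Unfolding: `F` is cut according to which `γ` moves a point into `S`, and each piece is
  -- translated into `S` by right invariance.
  have hmove : ∀ γ : Γ, ∫⁻ g in F ∩ (fun g => g * (γ : G)) ⁻¹' S, φ g ∂m =
      ∫⁻ g in S, ((fun g => g * (γ : G)⁻¹) ⁻¹' F).indicator φ g ∂m := by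
    intro γ
    rw [← lintegral_indicator (hF.inter (hpre' γ)), ← lintegral_indicator hS,
      ← lintegral_mul_right_eq_self (S.indicator _) (γ : G)]
    congr 1
    funext g
    simp only [Set.indicator_apply, Set.mem_inter_iff, Set.mem_preimage, mul_inv_cancel_right,
      hφΓ g γ γ.2]
    by_cases h1 : g ∈ F <;> by_cases h2 : g * (γ : G) ∈ S <;> simp [h1, h2]
  calc ∫⁻ g in F, φ g ∂m ≤ ∫⁻ g in ⋃ γ : Γ, F ∩ (fun g => g * (γ : G)) ⁻¹' S, φ g ∂m :=
        lintegral_mono_set hsub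
    _ ≤ ∑' γ : Γ, ∫⁻ g in F ∩ (fun g => g * (γ : G)) ⁻¹' S, φ g ∂m := lintegral_iUnion_le _ _
    _ = ∫⁻ g in S, ∑' γ : Γ, ((fun g => g * (γ : G)⁻¹) ⁻¹' F).indicator φ g ∂m := by
        rw [lintegral_tsum fun γ : Γ => (hφ.indicator (hpre _)).aemeasurable]
        exact tsum_congr hmove
    _ ≤ ∫⁻ g in S, φ g ∂m := by
        -- The translates of `F` by elements of `Γ` are disjoint, so at most one term of the sum is
        -- nonzero at `g`.
        refine lintegral_mono fun g => ?_
        by_cases h : ∃ γ : Γ, g * (γ : G)⁻¹ ∈ F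
        · obtain ⟨γ, hγ⟩ := h
          rw [tsum_eq_single γ fun δ hδ => ?_]
          · exact Set.indicator_le_self _ _ _
          · refine Set.indicator_of_notMem (fun hδF => hδ ?_) _
            have h1 := hFinj _ hγ ((γ : G) * (δ : G)⁻¹) (Γ.mul_mem γ.2 (Γ.inv_mem δ.2))
              (by simpa [mul_assoc] using hδF)
            exact Subtype.ext (mul_inv_eq_one.1 h1).symm
        · push Not at h
          have : ∀ γ : Γ, ((fun g => g * (γ : G)⁻¹) ⁻¹' F).indicator φ g = 0 := fun γ =>
            Set.indicator_of_notMem (s := (fun g => g * (γ : G)⁻¹) ⁻¹' F) (h γ) _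
          simp [this]

/-! ### Lattice sums with values in `[0, ∞]` -/

section
open Matrix

/-- The sum of `F` over the nonzero vectors of a lattice. -/
noncomputable def latticeSum (F : (Fin 3 → ℝ) → ENNReal) (x : LatticeSpace) : ENNReal :=
  ∑' v : ↥((x.lattice : Set (Fin 3 → ℝ)) \ {0}), F v

theorem sum_smul_cols (g : SL3R) (z : Fin 3 → ℤ) :
    ∑ j, (z j : ℝ) • g.cols j = g.1 *ᵥ fun j => (z j : ℝ) := by
  ext i
  simp [SL3R.cols, Matrix.mulVec, dotProduct, mul_comm]

theorem sum_smul_cols_injective (g : SL3R) :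
    Function.Injective fun z : Fin 3 → ℤ => ∑ j, (z j : ℝ) • g.cols j := by
  intro z z' h
  simp only [sum_smul_cols] at h
  have hinj := Matrix.mulVec_injective_of_isUnit (A := g.1)
    ((Matrix.isUnit_iff_isUnit_det _).2 (by rw [g.2]; exact isUnit_one))
  have h' := hinj h
  funext j
  exact_mod_cast congrFun h' j

theorem mem_lattice_mk (g : SL3R) (v : Fin 3 → ℝ) :
    v ∈ LatticeSpace.lattice (QuotientGroup.mk g) ↔
      ∃ z : Fin 3 → ℤ, ∑ j, (z j : ℝ) • g.cols j = v := by
  have h := Submodule.mem_span_range_iff_exists_fun ℤ (v := g.cols) (x := v)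
  refine Iff.trans h ?_
  simp only [Int.cast_smul_eq_zsmul]

theorem latticeSum_mk (F : (Fin 3 → ℝ) → ENNReal) (g : SL3R) :
    latticeSum F (QuotientGroup.mk g) =
      ∑' z : {z : Fin 3 → ℤ // z ≠ 0}, F (∑ j, (z.1 j : ℝ) • g.cols j) := by
  have hinj := sum_smul_cols_injective g
  have h0 : ∑ j, (((0 : Fin 3 → ℤ) j : ℤ) : ℝ) • g.cols j = 0 := by simp
  let e : {z : Fin 3 → ℤ // z ≠ 0} →
      ↥((LatticeSpace.lattice (QuotientGroup.mk g) : Set (Fin 3 → ℝ)) \ {0}) := fun z =>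
    ⟨∑ j, (z.1 j : ℝ) • g.cols j, (mem_lattice_mk g _).2 ⟨z.1, rfl⟩, fun h =>
      z.2 (hinj (h.trans h0.symm))⟩
  have he : Function.Bijective e := by
    constructor
    · intro z z' h
      exact Subtype.ext (hinj (congrArg Subtype.val h))
    · rintro ⟨v, hv, hv0⟩
      obtain ⟨z, rfl⟩ := (mem_lattice_mk g v).1 hv
      exact ⟨⟨z, fun h => hv0 (by rw [h]; exact h0)⟩, rfl⟩
  exact ((Equiv.ofBijective e he).tsum_eq fun v => F v.1).symm

theorem measurable_latticeSum {F : (Fin 3 → ℝ) → ENNReal} (hF : Measurable F) :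
    Measurable (latticeSum F) := by
  refine measurable_from_quotient.2 ?_
  have e : (latticeSum F ∘ Quotient.mk'' : SL3R → ENNReal) =
      fun g => ∑' z : {z : Fin 3 → ℤ // z ≠ 0}, F (∑ j, (z.1 j : ℝ) • g.cols j) := by
    funext g; exact latticeSum_mk F g
  rw [e]
  refine Measurable.tsum fun z => hF.comp ?_
  have hc : ∀ j, Continuous fun g : SL3R => g.cols j := fun j => continuous_pi fun i =>
    (continuous_apply j).comp ((continuous_apply i).comp continuous_subtype_val)
  exact (continuous_finsetSum _ fun j _ => (hc j).const_smul (z.1 j : ℝ)).measurable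

/-- No summability is needed: a divergent real series and `toReal` of ∞ both have value 0. -/
theorem siegelTransform_eq_toReal (f : (Fin 3 → ℝ) → ℝ) (hf : ∀ v, 0 ≤ f v) (x : LatticeSpace) :
    siegelTransform f x = (latticeSum (fun v => ENNReal.ofReal (f v)) x).toReal := by
  rw [latticeSum, ENNReal.tsum_toReal_eq fun _ => ENNReal.ofReal_ne_top]
  simp only [ENNReal.toReal_ofReal (hf _)]
  rfl

theorem latticeSum_mono {F H : (Fin 3 → ℝ) → ENNReal} (h : ∀ v, F v ≤ H v) (x : LatticeSpace) :
    latticeSum F x ≤ latticeSum H x :=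
  ENNReal.tsum_le_tsum fun v => h v.1

/-! ### Points of a reduced lattice in a cube, and their moments -/

/-- The indicator of the cube `[-r, r]³`. -/
noncomputable def cubeIndicator (r : ℝ) : (Fin 3 → ℝ) → ENNReal :=
  {v : Fin 3 → ℝ | ∀ i, |v i| ≤ r}.indicator fun _ => 1

theorem measurable_cubeIndicator (r : ℝ) : Measurable (cubeIndicator r) := by
  refine measurable_const.indicator ?_
  have : {v : Fin 3 → ℝ | ∀ i, |v i| ≤ r} = ⋂ i, {v | |v i| ≤ r} := by ext; simp
  rw [this]
  exact MeasurableSet.iInter fun i => measurableSet_le (by fun_prop) measurable_const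

/-- The five conditions are homogeneous, of degrees 2, 2, 4, 4 and 8, so reducedness passes between
a matrix and its radial projection. -/
theorem IsReducedBasis.smul {w : Fin 3 → Fin 3 → ℝ} (hw : IsReducedBasis w) {t : ℝ}
    (ht : 0 < t) : IsReducedBasis (t • w) := by
  have e1 : ∀ i j, (t • w) i ⬝ᵥ (t • w) j = t ^ 2 * (w i ⬝ᵥ w j) := fun i j => by
    simp only [dotProduct, Fin.sum_univ_three, Pi.smul_apply, smul_eq_mul]; ring
  have e2 : gramTwo ((t • w) 0) ((t • w) 1) = t ^ 4 * gramTwo (w 0) (w 1) := by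
    simp only [gramTwo, e1]; ring
  have e3 : orthComponent ((t • w) 0) ((t • w) 1) ⬝ᵥ (t • w) 2 =
      t ^ 4 * (orthComponent (w 0) (w 1) ⬝ᵥ w 2) := by
    simp only [orthComponent, dotProduct, Fin.sum_univ_three, Pi.smul_apply, Pi.sub_apply,
      smul_eq_mul]; ring
  have e4 : (colMatrix (t • w)).det = t ^ 3 * (colMatrix w).det := by
    simp only [colMatrix_det, Pi.smul_apply, smul_eq_mul]; ring
  have t2 : 0 < t ^ 2 := by positivity
  have t4 : 0 < t ^ 4 := by positivity
  have t8 : 0 < t ^ 8 := by positivity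
  refine ⟨?_, ?_, ?_, ?_, ?_⟩
  · rw [e1, e1, abs_mul, abs_of_pos t2, mul_div_assoc]
    exact mul_le_mul_of_nonneg_left hw.abs_dot_one t2.le
  · rw [e1, e1, abs_mul, abs_of_pos t2, mul_div_assoc]
    exact mul_le_mul_of_nonneg_left hw.abs_dot_two t2.le
  · rw [e3, e2, abs_mul, abs_of_pos t4, mul_div_assoc]
    exact mul_le_mul_of_nonneg_left hw.abs_orth_two t4.le
  · rw [e1, e2]
    calc _ = t ^ 4 * ((w 0 ⬝ᵥ w 0) ^ 2 / 2) := by ring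
      _ ≤ _ := mul_le_mul_of_nonneg_left hw.sq_le_gram t4.le
  · rw [e1, e2, e4]
    calc _ = t ^ 8 * (gramTwo (w 0) (w 1) ^ 2 / 2) := by ring
      _ ≤ t ^ 8 * ((w 0 ⬝ᵥ w 0) * (colMatrix w).det ^ 2) :=
        mul_le_mul_of_nonneg_left hw.gram_sq_le t8.le
      _ = _ := by ring

theorem isReducedBasis_of_coneMap {w : Fin 3 → Fin 3 → ℝ} (h : 0 < (colMatrix w).det)
    (hw : IsReducedBasis (coneMap w).cols) : IsReducedBasis w := by
  rw [coneMap_cols h] at hw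
  have ht : 0 < (colMatrix w).det ^ (-(1 / 3) : ℝ) := Real.rpow_pos_of_pos h _
  have := hw.smul (inv_pos.2 ht)
  rwa [smul_smul, inv_mul_cancel₀ ht.ne', one_smul] at this

/-- The count of nonzero points of a reduced unimodular lattice in a cube. -/
theorem latticeSum_cubeIndicator_le {w : Fin 3 → Fin 3 → ℝ} (hw : w ∈ reducedSet) {r R : ℝ}
    (hr : 0 ≤ r) (hrR : r ≤ R) :
    latticeSum (cubeIndicator r) (QuotientGroup.mk (coneMap w)) ≤
      ENNReal.ofReal (160 * (8 * R + 1) * (16 * R + 1) * r * flagPotential w ^ (-(1 / 3) : ℝ)) := by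
  classical
  obtain ⟨hred, hD1, hD2⟩ := hw
  have hD0 : 0 < (colMatrix w).det := by linarith
  have hQ : 0 ≤ flagPotential w ^ (-(1 / 3) : ℝ) := by
    obtain ⟨h1, h2⟩ := gram_pos_of_one_le_det hD1
    exact Real.rpow_nonneg (mul_pos h1 h2).le _
  rw [latticeSum_mk, ENNReal.tsum_eq_iSup_sum]
  refine iSup_le fun A => ?_
  set t := (colMatrix w).det ^ (-(1 / 3) : ℝ) with ht
  have ht0 : 0 < t := Real.rpow_pos_of_pos hD0 _
  have ht2 : 1 / 2 ≤ t := by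
    rw [ht, Real.rpow_neg hD0.le, one_div]
    refine inv_anti₀ (by positivity) ?_
    calc (colMatrix w).det ^ (1 / 3 : ℝ) ≤ (colMatrix w).det ^ (1 : ℝ) :=
          Real.rpow_le_rpow_of_exponent_le hD1 (by norm_num)
      _ ≤ 2 := by rw [Real.rpow_one]; exact hD2
  let P : {z : Fin 3 → ℤ // z ≠ 0} → Prop := fun z =>
    ∀ i, |(∑ j, (z.1 j : ℝ) • (coneMap w).cols j) i| ≤ r
  have hsum : ∑ z ∈ A, cubeIndicator r (∑ j, (z.1 j : ℝ) • (coneMap w).cols j) =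
      ((A.filter P).card : ENNReal) := by
    rw [Finset.card_filter, Nat.cast_sum]
    refine Finset.sum_congr rfl fun z _ => ?_
    simp only [cubeIndicator, Set.indicator_apply, Set.mem_ofPred_eq]
    split_ifs <;> simp
  rw [hsum]
  -- Undoing the normalisation stretches by `t⁻¹ ≤ 2`, hence the doubled radii.
  have hcard := hred.card_le hD1 hD2 (ρ := 2 * r) (R := 2 * R) (by positivity) (by linarith)
    ((A.filter P).map (Function.Embedding.subtype _)) (by simp) (by
      intro z hz i
      obtain ⟨z', hz', rfl⟩ := Finset.mem_map.1 hz
      have hP := (Finset.mem_filter.1 hz').2 i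
      rw [coneMap_cols hD0, ← ht] at hP
      have e : (∑ j, (z'.1 j : ℝ) • (t • w) j) i = t * (∑ j, (z'.1 j : ℝ) • w j) i := by
        simp only [Finset.sum_apply, Pi.smul_apply, smul_eq_mul, Finset.mul_sum]
        exact Finset.sum_congr rfl fun _ _ => by ring
      rw [e, abs_mul, abs_of_pos ht0] at hP
      change |(∑ j, (z'.1 j : ℝ) • w j) i| ≤ 2 * r
      nlinarith [abs_nonneg ((∑ j, (z'.1 j : ℝ) • w j) i)])
  rw [Finset.card_map] at hcard
  rw [← ENNReal.ofReal_natCast]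
  refine ENNReal.ofReal_le_ofReal (hcard.trans (le_of_eq ?_))
  ring

/-- The elements of `SL₃(ℝ)` whose columns form a reduced basis. -/
def reducedElements : Set SL3R := {g | IsReducedBasis g.cols}

theorem measurableSet_reducedElements : MeasurableSet reducedElements := by
  have : Continuous SL3R.cols := continuous_pi fun j => continuous_pi fun i =>
    (continuous_apply j).comp ((continuous_apply i).comp continuous_subtype_val)
  exact this.measurable measurableSet_isReducedBasis

/-- Moments of the counting function of a cube over the reduced elements. -/
theorem exists_setLIntegral_reducedElements_le {p : ℝ} (hp0 : 0 ≤ p) (hp3 : p < 3) {R : ℝ}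
    (hR : 0 ≤ R) : ∃ K : ENNReal, K ≠ ⊤ ∧ ∀ r, 0 ≤ r → r ≤ R →
      ∫⁻ g in reducedElements, latticeSum (cubeIndicator r) (QuotientGroup.mk g) ^ p ∂coneMeasure ≤
        K * ENNReal.ofReal r ^ p := by
  set M : ℝ := 160 * (8 * R + 1) * (16 * R + 1) with hM
  have hM0 : 0 ≤ M := by positivity
  refine ⟨ENNReal.ofReal M ^ p *
    ∫⁻ w in reducedSet, ENNReal.ofReal (flagPotential w) ^ (-(p / 3)),
    ENNReal.mul_ne_top (ENNReal.rpow_ne_top_of_nonneg hp0 ENNReal.ofReal_ne_top)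
      (lintegral_flagPotential_lt_top hp0 hp3).ne, fun r hr hrR => ?_⟩
  have hmeas : Measurable fun g : SL3R =>
      latticeSum (cubeIndicator r) (QuotientGroup.mk g) ^ p :=
    ((measurable_latticeSum (measurable_cubeIndicator r)).comp measurable_quotient_mk'').pow_const p
  rw [coneMeasure, setLIntegral_map measurableSet_reducedElements hmeas measurable_coneMap,
    Measure.restrict_restrict (measurable_coneMap measurableSet_reducedElements)]
  have hsub : coneMap ⁻¹' reducedElements ∩ detSlab ⊆ reducedSet := by
    rintro w ⟨h1, h2⟩
    exact ⟨isReducedBasis_of_coneMap (lt_of_lt_of_le one_pos h2.1) h1, h2⟩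
  refine (lintegral_mono_set hsub).trans ?_
  have hpt : ∀ w ∈ reducedSet, latticeSum (cubeIndicator r) (QuotientGroup.mk (coneMap w)) ^ p ≤
      ENNReal.ofReal M ^ p * ENNReal.ofReal r ^ p *
        ENNReal.ofReal (flagPotential w) ^ (-(p / 3)) := by
    intro w hw
    obtain ⟨h1, h2⟩ := gram_pos_of_one_le_det hw.2.1
    have hQ : 0 < flagPotential w := mul_pos h1 h2
    refine (ENNReal.rpow_le_rpow (latticeSum_cubeIndicator_le hw hr hrR) hp0).trans (le_of_eq ?_)
    rw [ENNReal.ofReal_mul (by positivity), ENNReal.ofReal_mul (by positivity),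
      ENNReal.mul_rpow_of_nonneg _ _ hp0, ENNReal.mul_rpow_of_nonneg _ _ hp0,
      ← ENNReal.ofReal_rpow_of_pos hQ, ← ENNReal.rpow_mul]
    congr 2
    ring
  refine (setLIntegral_mono' measurableSet_reducedSet hpt).trans (le_of_eq ?_)
  rw [lintegral_const_mul']
  · ring
  · exact ENNReal.mul_ne_top (ENNReal.rpow_ne_top_of_nonneg hp0 ENNReal.ofReal_ne_top)
      (ENNReal.rpow_ne_top_of_nonneg hp0 ENNReal.ofReal_ne_top)

end

/-! ### The coset representatives -/

instance : Countable SL3Z := by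
  have : Countable (Matrix (Fin 3) (Fin 3) ℤ) := inferInstanceAs (Countable (Fin 3 → Fin 3 → ℤ))
  have : Countable (Matrix.SpecialLinearGroup (Fin 3) ℤ) :=
    inferInstanceAs (Countable {A : Matrix (Fin 3) (Fin 3) ℤ // A.det = 1})
  exact (MonoidHom.rangeRestrict_surjective
    (Matrix.SpecialLinearGroup.map (n := Fin 3) (Int.castRingHom ℝ))).countable

theorem measurableSet_cosetRepresentatives : MeasurableSet cosetRepresentatives :=
  exists_borel_representatives.choose_spec.1

theorem existsUnique_mem_cosetRepresentatives (x : LatticeSpace) :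
    ∃! g : SL3R, g ∈ cosetRepresentatives ∧ (QuotientGroup.mk g : LatticeSpace) = x :=
  exists_borel_representatives.choose_spec.2 x

theorem mk_mul_mem {g γ : SL3R} (hγ : γ ∈ SL3Z) :
    (QuotientGroup.mk (g * γ) : LatticeSpace) = QuotientGroup.mk g :=
  QuotientGroup.mk_mul_of_mem g hγ

/-- Countably many translates of the representatives cover the group. Nonvanishing keeps the
normalising factor of `latticeMeasure` finite. -/
theorem coneMeasure_cosetRepresentatives_ne_zero : coneMeasure cosetRepresentatives ≠ 0 := by
  intro h0
  apply coneMeasure_ne_zero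
  have hcov : (Set.univ : Set SL3R) ⊆ ⋃ γ : SL3Z, (fun g => g * (γ : SL3R)) ⁻¹' cosetRepresentatives := by
    intro g _
    obtain ⟨h, ⟨hF, hh⟩, -⟩ := existsUnique_mem_cosetRepresentatives (QuotientGroup.mk g)
    refine Set.mem_iUnion.2 ⟨⟨g⁻¹ * h, QuotientGroup.eq.1 hh.symm⟩, ?_⟩
    simpa using hF
  refine Measure.measure_univ_eq_zero.1 (measure_mono_null hcov (measure_iUnion_null fun γ => ?_))
  rw [measure_preimage_mul_right, h0]

/-- The upper bound for moments over the fundamental domain, after a translation. -/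
theorem setLIntegral_cosetRepresentatives_le (a : SL3R) {φ : LatticeSpace → ENNReal}
    (hφ : Measurable φ) :
    ∫⁻ g in cosetRepresentatives, φ (QuotientGroup.mk (a * g)) ∂coneMeasure ≤
      ∫⁻ g in reducedElements, φ (QuotientGroup.mk g) ∂coneMeasure := by
  have hm : Measurable fun g : SL3R => φ (QuotientGroup.mk g) := hφ.comp measurable_quotient_mk''
  have hF := measurableSet_cosetRepresentatives
  have hF' : MeasurableSet ((fun g => a⁻¹ * g) ⁻¹' cosetRepresentatives) :=
    measurable_const_mul a⁻¹ hF
  have e : ∫⁻ g in cosetRepresentatives, φ (QuotientGroup.mk (a * g)) ∂coneMeasure =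
      ∫⁻ g in (fun g => a⁻¹ * g) ⁻¹' cosetRepresentatives, φ (QuotientGroup.mk g) ∂coneMeasure := by
    rw [← lintegral_indicator hF, ← lintegral_indicator hF',
      ← lintegral_mul_left_eq_self (Set.indicator ((fun g => a⁻¹ * g) ⁻¹' cosetRepresentatives) _) a]
    classical
    refine lintegral_congr fun g => ?_
    simp only [Set.indicator_apply, Set.mem_preimage, inv_mul_cancel_left]
  rw [e]
  -- The translate aF still has at most one element in each coset, so it can be compared with the
  -- reduced elements directly; this replaces the invariance of μ under `a`.
  refine setLIntegral_le_of_forall_exists_mul_mem coneMeasure SL3Z hF'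
    measurableSet_reducedElements ?_ exists_isReducedBasis hm fun g γ hγ => by rw [mk_mul_mem hγ]
  intro g hg γ hγ hgγ
  obtain ⟨h, -, huniq⟩ := existsUnique_mem_cosetRepresentatives (QuotientGroup.mk (a⁻¹ * g))
  have h1 := huniq _ ⟨hg, rfl⟩
  have h2 := huniq _ ⟨hgγ, by
    change (QuotientGroup.mk (a⁻¹ * (g * γ)) : LatticeSpace) = _
    rw [← mul_assoc]; exact mk_mul_mem hγ⟩
  have h3 := h2.trans h1.symm
  simpa using h3

/-! ### From boxes to cubes, and the final bound -/

/-- The indicator of the box `[-c, c]² × [-β, β]`. -/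
noncomputable def boxIndicator (c β : ℝ) : (Fin 3 → ℝ) → ENNReal :=
  {v : Fin 3 → ℝ | |v 0| ≤ c ∧ |v 1| ≤ c ∧ |v 2| ≤ β}.indicator fun _ => 1

theorem measurable_boxIndicator (c β : ℝ) : Measurable (boxIndicator c β) := by
  refine measurable_const.indicator ?_
  have : ∀ i (t : ℝ), MeasurableSet {v : Fin 3 → ℝ | |v i| ≤ t} := fun i t =>
    measurableSet_le (by fun_prop) measurable_const
  exact (this 0 c).inter ((this 1 c).inter (this 2 β))

/-- A diagonal matrix carries a box to the cube of the same volume. -/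
theorem exists_translate_box {c β : ℝ} (hc : 0 < c) (hβ : 0 < β) : ∃ a : SL3R, ∀ g : SL3R,
    latticeSum (boxIndicator c β) (QuotientGroup.mk g) ≤
      latticeSum (cubeIndicator ((c ^ 2 * β) ^ (1 / 3 : ℝ))) (QuotientGroup.mk (a * g)) := by
  set r := (c ^ 2 * β) ^ (1 / 3 : ℝ) with hr
  have hr0 : 0 < r := by positivity
  have hr3 : r ^ 3 = c ^ 2 * β := by
    rw [hr, ← Real.rpow_natCast, ← Real.rpow_mul (by positivity)]; norm_num
  -- The entries carry the sides of the box to `r`; the determinant r³/(c²β) is 1 by the choice of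
  -- `r`.
  let d : Fin 3 → ℝ := ![r / c, r / c, r / β]
  have hdet : (Matrix.diagonal d).det = 1 := by
    rw [Matrix.det_diagonal, Fin.prod_univ_three]
    simp only [d, Matrix.cons_val_zero, Matrix.cons_val_one, Matrix.cons_val]
    field_simp
    linarith
  obtain ⟨a, ha⟩ : ∃ a : SL3R, a.1 = Matrix.diagonal d := ⟨⟨_, hdet⟩, rfl⟩
  refine ⟨a, fun g => ?_⟩
  rw [latticeSum_mk, latticeSum_mk]
  refine ENNReal.tsum_le_tsum fun z => ?_
  have hcol : ∀ i, (∑ j, (z.1 j : ℝ) • (a * g).cols j) i =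
      d i * (∑ j, (z.1 j : ℝ) • g.cols j) i := fun i => by
    simp only [SL3R.cols, Finset.sum_apply, Pi.smul_apply, smul_eq_mul, Finset.mul_sum,
      Matrix.SpecialLinearGroup.coe_mul, ha, Matrix.diagonal_mul]
    exact Finset.sum_congr rfl fun _ _ => by ring
  by_cases hv : (∑ j, (z.1 j : ℝ) • g.cols j) ∈ {v : Fin 3 → ℝ | |v 0| ≤ c ∧ |v 1| ≤ c ∧ |v 2| ≤ β}
  · have hscale : ∀ x t : ℝ, 0 < t → |x| ≤ t → |r / t * x| ≤ r := fun x t ht hx => by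
      rw [abs_mul, abs_of_pos (by positivity), div_mul_eq_mul_div, div_le_iff₀ ht]
      exact mul_le_mul_of_nonneg_left hx hr0.le
    have hv' : (∑ j, (z.1 j : ℝ) • (a * g).cols j) ∈
        {v : Fin 3 → ℝ | ∀ i, |v i| ≤ r} := by
      intro i
      rw [hcol]
      fin_cases i
      · exact hscale _ _ hc hv.1
      · exact hscale _ _ hc hv.2.1
      · exact hscale _ _ hβ hv.2.2
    rw [boxIndicator, cubeIndicator, Set.indicator_of_mem hv, Set.indicator_of_mem hv']
  · rw [boxIndicator, Set.indicator_of_notMem hv]; exact zero_le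

theorem lintegral_latticeMeasure {κ : NNReal} (hκ : κ ≠ 0)
    (hcone : coneMeasure = κ • (Measure.haar : Measure SL3R)) {φ : LatticeSpace → ENNReal}
    (hφ : Measurable φ) :
    ∫⁻ x, φ x ∂latticeMeasure = (Measure.haar cosetRepresentatives)⁻¹ * ((κ : ENNReal)⁻¹ *
      ∫⁻ g in cosetRepresentatives, φ (QuotientGroup.mk g) ∂coneMeasure) := by
  have hκ' : (κ : ENNReal) ≠ 0 := by exact_mod_cast hκ
  rw [latticeMeasure, lintegral_map hφ measurable_quotient_mk'', ProbabilityTheory.cond,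
    lintegral_smul_measure, smul_eq_mul, hcone, Measure.restrict_smul, lintegral_smul_measure]
  congr 1
  rw [ENNReal.smul_def, smul_eq_mul, ← mul_assoc, ENNReal.inv_mul_cancel hκ' ENNReal.coe_ne_top,
    one_mul]

/-- Moments of the number of nonzero lattice points in a box. -/
theorem exists_lintegral_boxIndicator_le {c B p : ℝ} (hc : 0 < c) (hp0 : 0 ≤ p) (hp3 : p < 3) :
    ∃ C : ℝ, 0 ≤ C ∧ ∀ β : ℝ, 0 < β → β ≤ B →
      ∫⁻ x, latticeSum (boxIndicator c β) x ^ p ∂latticeMeasure ≤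
        ENNReal.ofReal (C * β ^ (p / 3)) := by
  obtain ⟨κ, hκ, hcone⟩ := exists_coneMeasure_eq_smul_haar
  have hκ' : (κ : ENNReal) ≠ 0 := by exact_mod_cast hκ
  have hF0 : Measure.haar cosetRepresentatives ≠ 0 := by
    intro h
    apply coneMeasure_cosetRepresentatives_ne_zero
    rw [hcone, Measure.smul_apply, h, smul_zero]
  obtain ⟨K, hK, hKr⟩ := exists_setLIntegral_reducedElements_le hp0 hp3
    (R := (c ^ 2 * |B|) ^ (1 / 3 : ℝ)) (by positivity)
  set N : ENNReal := (Measure.haar cosetRepresentatives)⁻¹ * ((κ : ENNReal)⁻¹ * K) with hN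
  have hNtop : N ≠ ⊤ := ENNReal.mul_ne_top (ENNReal.inv_ne_top.2 hF0)
    (ENNReal.mul_ne_top (ENNReal.inv_ne_top.2 hκ') hK)
  refine ⟨N.toReal * (c ^ 2) ^ (p / 3), by positivity, fun β hβ hβB => ?_⟩
  obtain ⟨a, ha⟩ := exists_translate_box hc hβ
  set r := (c ^ 2 * β) ^ (1 / 3 : ℝ) with hr
  have hr0 : 0 ≤ r := by positivity
  have hrR : r ≤ (c ^ 2 * |B|) ^ (1 / 3 : ℝ) := by
    refine Real.rpow_le_rpow (by positivity) ?_ (by norm_num)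
    exact mul_le_mul_of_nonneg_left (hβB.trans (le_abs_self B)) (by positivity)
  rw [lintegral_latticeMeasure hκ hcone
    ((measurable_latticeSum (measurable_boxIndicator c β)).pow_const p)]
  have h1 : ∫⁻ g in cosetRepresentatives, latticeSum (boxIndicator c β) (QuotientGroup.mk g) ^ p
      ∂coneMeasure ≤ K * ENNReal.ofReal r ^ p := by
    refine (lintegral_mono fun g => ENNReal.rpow_le_rpow (ha g) hp0).trans ?_
    exact (setLIntegral_cosetRepresentatives_le a
      ((measurable_latticeSum (measurable_cubeIndicator r)).pow_const p)).trans (hKr r hr0 hrR)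
  -- The cube has the volume of the box, so `r ^ p` is the source of the exponent p/3.
  have h2 : ENNReal.ofReal r ^ p = ENNReal.ofReal ((c ^ 2) ^ (p / 3) * β ^ (p / 3)) := by
    rw [ENNReal.ofReal_rpow_of_nonneg hr0 hp0, hr, ← Real.rpow_mul (by positivity),
      ← Real.mul_rpow (by positivity) hβ.le]
    congr 2; ring
  calc _ ≤ (Measure.haar cosetRepresentatives)⁻¹ * ((κ : ENNReal)⁻¹ * (K * ENNReal.ofReal r ^ p)) := by
        gcongr
    _ = N * ENNReal.ofReal r ^ p := by rw [hN]; ring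
    _ = _ := by
        rw [h2, mul_assoc N.toReal, ENNReal.ofReal_mul ENNReal.toReal_nonneg, ENNReal.ofReal_toReal hNtop]

/-- The implied bound `β ≪ 1` is expressed by `β ≤ B`, for an arbitrary `B` on which the constant
may depend. -/
theorem mainTheorem7 (c : ℝ) (hc : 0 < c) (B : ℝ) (p : ℝ) (hp0 : 0 ≤ p) (hp3 : p < 3) :
    ∃ C : ℝ, ∀ β : ℝ, 0 < β → β ≤ B →
      ∀ f : (Fin 3 → ℝ) → ℝ, (∀ v, f v ∈ Set.Icc (0 : ℝ) 1) →
        (∀ v, f v ≠ 0 → |v 0| ≤ c ∧ |v 1| ≤ c ∧ |v 2| ≤ β) →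
        (∫⁻ x, ENNReal.ofReal (siegelTransform f x ^ p) ∂latticeMeasure
            ≤ ENNReal.ofReal (C * β ^ (p / 3))) ∧
        (Measurable f →
          Integrable (fun x => siegelTransform f x ^ p) latticeMeasure ∧
          ∫ x, siegelTransform f x ^ p ∂latticeMeasure ≤ C * β ^ (p / 3)) := by
  obtain ⟨C, hC, hbound⟩ := exists_lintegral_boxIndicator_le (B := B) hc hp0 hp3
  refine ⟨C, fun β hβ hβB f hf hsupp => ?_⟩
  have hs0 : ∀ x, 0 ≤ siegelTransform f x := fun x => by
    rw [siegelTransform_eq_toReal f fun v => (hf v).1]; exact ENNReal.toReal_nonneg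
  have hle : ∀ v, ENNReal.ofReal (f v) ≤ boxIndicator c β v := fun v => by
    by_cases hv : f v = 0
    · rw [hv, ENNReal.ofReal_zero]; exact zero_le
    · have hmem : v ∈ {v : Fin 3 → ℝ | |v 0| ≤ c ∧ |v 1| ≤ c ∧ |v 2| ≤ β} := hsupp v hv
      rw [boxIndicator, Set.indicator_of_mem hmem]
      exact ENNReal.ofReal_le_one.2 (hf v).2
  have hmain : ∫⁻ x, ENNReal.ofReal (siegelTransform f x ^ p) ∂latticeMeasure
      ≤ ENNReal.ofReal (C * β ^ (p / 3)) := by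
    -- The comparison with the box count is pointwise, so this bound holds for non-measurable `f` as
    -- well.
    refine (lintegral_mono fun x => ?_).trans (hbound β hβ hβB)
    rw [← ENNReal.ofReal_rpow_of_nonneg (hs0 x) hp0]
    refine ENNReal.rpow_le_rpow ?_ hp0
    rw [siegelTransform_eq_toReal f fun v => (hf v).1]
    exact ENNReal.ofReal_toReal_le.trans (latticeSum_mono hle x)
  refine ⟨hmain, fun hfm => ?_⟩
  have hmeas : Measurable fun x => siegelTransform f x ^ p := by
    have e : siegelTransform f = fun x =>
        (latticeSum (fun v => ENNReal.ofReal (f v)) x).toReal :=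
      funext fun x => siegelTransform_eq_toReal f (fun v => (hf v).1) x
    rw [e]
    exact (measurable_latticeSum hfm.ennreal_ofReal).ennreal_toReal.pow_const p
  have hnn : ∀ x, 0 ≤ siegelTransform f x ^ p := fun x => Real.rpow_nonneg (hs0 x) p
  refine ⟨⟨hmeas.aestronglyMeasurable, ?_⟩, ?_⟩
  · rw [hasFiniteIntegral_iff_ofReal (Filter.Eventually.of_forall hnn)]
    exact hmain.trans_lt ENNReal.ofReal_lt_top
  · rw [integral_eq_lintegral_of_nonneg_ae (Filter.Eventually.of_forall hnn)
      hmeas.aestronglyMeasurable]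
    exact ENNReal.toReal_le_of_le_ofReal (by positivity) hmain
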